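/- **Proposition 2.1 (General existence of singular solitons).** Let $n\ge 2$ be an integer and $\lambda\in\mathbb R$. Consider the system, with $'=\frac{d}{dy}$, $$W'=W(X^2-\lambda W^2),\qquad X'=X^3-X+\tfrac{Y^2}{\sqrt n}+\lambda(\sqrt n-X)W^2,\qquad Y'=Y\Big(X^2-\tfrac{X}{\sqrt n}-\lambda W^2\Big). \tag{1}$$ There is $\varepsilon>0$, depending only on $n$ and $\lambda$, such that for all initial data $(W_0,X_0,Y_0)$ with $W_0>0$, $Y_0>0$ and $|(W_0,X_0-1,Y_0)|<\varepsilon$ the following holds. 1. The system (1) has a solution $(W,X,Y)$ with $(W,X,Y)(0)=(W_0,X_0,Y_0)$ for all $y\in(-\infty,0]$. It is unique: any solution on an interval $[T,0]$, $T<0$, with the same value at $y=0$ agrees with it there. Moreover $W,Y>0$ on $(-\infty,0]$. 2. The solution corresponds to a gradient Ricci soliton. That is, there are $\delta>0$, a function $x=x(y)$ on $(-\infty,0]$ with $\frac{dx}{dy}=W$, $x\to0$ as $y\to-\infty$ and $x(0)=\delta$, and functions $\psi>0$ and $\phi$ that are smooth on $(0,\delta]$ (so $\psi$ and $\omega:=\dot\phi$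 have a smooth limit as $x\to\delta^-$; here $\dot{}=\frac{d}{dx}$), such that for all $y<0$, at $x=x(y)$, $$W=\frac{1}{-\omega+n\frac{\dot\psi}{\psi}},\qquad X=\sqrt n\,W\,\frac{\dot\psi}{\psi},\qquad Y=\frac{\sqrt{n(n-1)}\,W}{\psi},$$ and such that the metric $g=dx^2+\psi(x)^2g_{\mathbb S^n}$ on $(0,\delta)\times\mathbb S^n$ ($g_{\mathbb S^n}$ the round metric of the unit sphere) and the function $\phi=\phi(x)$ satisfy $$\mathrm{Ric}(g)+\nabla\nabla\phi+\lambda g=0\quad\text{on }(0,\delta)\times\mathbb S^n,$$ which amounts to $n\ddot\psi-\psi\dot\omega=\lambda\psi$ and $\psi\ddot\psi+(n-1)\dot\psi^2-(n-1)-\psi\dot\psi\omega=\lambda\psi^2$ on $(0,\delta)$. 3. As $x\to0^+$, $$\psi(x)\sim a\,x^{1/\sqrt n}\ \text{ for some } a>0,\qquad \omega(x)\sim\frac{\sqrt n-1}{x}.$$ In particular the metric extends to $x=0$ as a $C^0$ but not as a $C^1$ metric, in the following sense: $\psi$ extends to a continuous function on $[0,\delta)$ with value $0$ at $x=0$, but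 to no $C^1$ function on $[0,\delta)$. -/

import Mathlib

set_option maxSynthPendingDepth 3

open Set Filter Topology Asymptotics
open scoped Manifold ContDiff

noncomputable section

namespace RicciSoliton

section Coordinates

/-! Local Riemannian geometry of a metric `G` on (an open set of) a finite-dimensional real vector
space `E`: `G z u v` is the inner product at `z` of the vectors `u` and `v`. -/

variable {E : Type*} [NormedAddCommGroup E] [NormedSpace ℝ E]

/-- The rearrangement `(u, v, w) ↦ D (w, u, v)` of a trilinear form `D`. -/
def cyc (D : E →L[ℝ] E →L[ℝ] E →L[ℝ] ℝ) : E →L[ℝ] E →L[ℝ] E →L[ℝ] ℝ :=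
  ((ContinuousLinearMap.flipₗᵢ ℝ E E ℝ).toLinearIsometry.toContinuousLinearMap).comp D.flip

theorem cyc_apply (D : E →L[ℝ] E →L[ℝ] E →L[ℝ] ℝ) (u v w : E) : cyc D u v w = D w u v := rfl

/-- The Koszul expression
`(u, v, w) ↦ (1/2) (D_u G (v, w) + D_v G (u, w) - D_w G (u, v))` at the point `z`. -/
def koszul (G : E → E →L[ℝ] E →L[ℝ] ℝ) (z : E) : E →L[ℝ] E →L[ℝ] E →L[ℝ] ℝ :=
  (1 / 2 : ℝ) • (fderiv ℝ G z + (fderiv ℝ G z).flip - cyc (fderiv ℝ G z))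

theorem koszul_apply (G : E → E →L[ℝ] E →L[ℝ] ℝ) (z u v w : E) :
    koszul G z u v w =
      (1 / 2 : ℝ) * (fderiv ℝ G z u v w + fderiv ℝ G z v u w - fderiv ℝ G z w u v) := by
  simp [koszul, cyc_apply]

/-- The Christoffel symbols `Γ(u, v)` of the Levi-Civita connection: the index of the Koszul
expression is raised with the inverse of the metric, so `G (Γ(u, v), w) = koszul (u, v, w)`. -/
def christoffel (G : E → E →L[ℝ] E →L[ℝ] ℝ) (z : E) : E →L[ℝ] E →L[ℝ] E :=
  (ContinuousLinearMap.compL ℝ E (E →L[ℝ] ℝ) E (ContinuousLinearMap.inverse (G z))).comp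
    (koszul G z)

theorem christoffel_apply (G : E → E →L[ℝ] E →L[ℝ] ℝ) (z u v : E) :
    christoffel G z u v = ContinuousLinearMap.inverse (G z) (koszul G z u v) := rfl

/-- The curvature endomorphism `w ↦ R(w, u) v`, where
`R(w, u) v = D_w Γ (u, v) - D_u Γ (w, v) + Γ(w, Γ(u, v)) - Γ(u, Γ(w, v))`. -/
def curvature (G : E → E →L[ℝ] E →L[ℝ] ℝ) (z u v : E) : E →L[ℝ] E :=
  ((fderiv ℝ (christoffel G) z).flip u).flip v - (fderiv ℝ (christoffel G) z u).flip v
    + (christoffel G z).flip (christoffel G z u v)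
    - (christoffel G z u).comp ((christoffel G z).flip v)

theorem curvature_apply (G : E → E →L[ℝ] E →L[ℝ] ℝ) (z u v w : E) :
    curvature G z u v w =
      fderiv ℝ (christoffel G) z w u v - fderiv ℝ (christoffel G) z u w v
        + christoffel G z w (christoffel G z u v)
        - christoffel G z u (christoffel G z w v) := by
  simp [curvature]

/-- The Ricci tensor `Ric(u, v) = tr (w ↦ R(w, u) v)`. -/
def ricciCoord (G : E → E →L[ℝ] E →L[ℝ] ℝ) (z u v : E) : ℝ :=
  LinearMap.trace ℝ E (curvature G z u v : E →ₗ[ℝ] E)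

/-- The Hessian `∇∇f (u, v) = D²f (u, v) - Df (Γ(u, v))`. -/
def hessCoord (G : E → E →L[ℝ] E →L[ℝ] ℝ) (f : E → ℝ) (z u v : E) : ℝ :=
  fderiv ℝ (fderiv ℝ f) z u v - fderiv ℝ f z (christoffel G z u v)

end Coordinates

section Manifold

/-! The same notions on a manifold (without boundary), at a point `p`, computed in the preferred
chart at `p`. The tangent space at `p` is, in Mathlib, the model vector space `E`, identified
through that chart. -/

variable {E : Type*} [NormedAddCommGroup E] [NormedSpace ℝ E] {H : Type*} [TopologicalSpace H]
  (I : ModelWithCorners ℝ E H) {M : Type*} [TopologicalSpace M] [ChartedSpace H M]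

/-- The metric `g` read in the preferred chart at `p`: the pullback of `g` under the inverse of
that chart. -/
def chartMetric (g : ∀ q : M, TangentSpace I q →L[ℝ] TangentSpace I q →L[ℝ] ℝ) (p : M) (z : E) :
    E →L[ℝ] E →L[ℝ] ℝ :=
  ContinuousLinearMap.bilinearComp (E := E) (F := E) (E' := E) (F' := E)
    (g ((extChartAt I p).symm z))
    (mfderiv 𝓘(ℝ, E) I (extChartAt I p).symm z) (mfderiv 𝓘(ℝ, E) I (extChartAt I p).symm z)

/-- The Ricci tensor of `g` at `p`. -/
def ricci (g : ∀ q : M, TangentSpace I q →L[ℝ] TangentSpace I q →L[ℝ] ℝ) (p : M)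
    (u v : TangentSpace I p) : ℝ :=
  ricciCoord (chartMetric I g p) (extChartAt I p p) u v

/-- The Hessian (second covariant derivative) of the function `f` with respect to `g` at `p`. -/
def hessian (g : ∀ q : M, TangentSpace I q →L[ℝ] TangentSpace I q →L[ℝ] ℝ) (f : M → ℝ) (p : M)
    (u v : TangentSpace I p) : ℝ :=
  hessCoord (chartMetric I g p) (f ∘ (extChartAt I p).symm) (extChartAt I p p) u v

/-- The gradient Ricci soliton equation `Ric(g) + ∇∇f + lam g = 0` on the open subset `U`. -/
def IsGradientSolitonOn (g : ∀ q : M, TangentSpace I q →L[ℝ] TangentSpace I q →L[ℝ] ℝ)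
    (f : M → ℝ) (lam : ℝ) (U : Set M) : Prop :=
  ∀ p ∈ U, ∀ u v : TangentSpace I p, ricci I g p u v + hessian I g f p u v + lam * g p u v = 0

end Manifold

/-- The unit sphere `S^n` in `ℝ^(n+1)`. -/
abbrev Sph (n : ℕ) : Type := Metric.sphere (0 : EuclideanSpace ℝ (Fin (n + 1))) 1

/-- The model with corners of the product manifold `ℝ × S^n`. -/
abbrev cylModel (n : ℕ) := (𝓘(ℝ, ℝ)).prod (𝓡 n)

/-- The differential at `p` of the projection `(x, θ) ↦ x`, i.e. the one-form `dx`. -/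
def dx (n : ℕ) (p : ℝ × Sph n) : TangentSpace (cylModel n) p →L[ℝ] ℝ :=
  mfderiv (cylModel n) 𝓘(ℝ, ℝ) (fun q : ℝ × Sph n => q.1) p

/-- The differential at `p` of `(x, θ) ↦ θ ∈ ℝ^(n+1)`. -/
def dθ (n : ℕ) (p : ℝ × Sph n) :
    TangentSpace (cylModel n) p →L[ℝ] EuclideanSpace ℝ (Fin (n + 1)) :=
  mfderiv (cylModel n) 𝓘(ℝ, EuclideanSpace ℝ (Fin (n + 1)))
    (fun q : ℝ × Sph n => (q.2 : EuclideanSpace ℝ (Fin (n + 1)))) p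

/-- The warped product metric `dx² + ψ(x)² g_{S^n}` on `ℝ × S^n`, where the round metric `g_{S^n}`
is induced by the Euclidean inner product of `ℝ^(n+1)`. -/
def warpedMetric (n : ℕ) (ψ : ℝ → ℝ) (p : ℝ × Sph n) :
    TangentSpace (cylModel n) p →L[ℝ] TangentSpace (cylModel n) p →L[ℝ] ℝ :=
  ContinuousLinearMap.bilinearComp (E := ℝ) (F := ℝ)
      (E' := ℝ × EuclideanSpace ℝ (Fin n)) (F' := ℝ × EuclideanSpace ℝ (Fin n))
      (innerSL ℝ) (dx n p) (dx n p)
    + (ψ p.1 ^ 2) • ContinuousLinearMap.bilinearComp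
        (E := EuclideanSpace ℝ (Fin (n + 1))) (F := EuclideanSpace ℝ (Fin (n + 1)))
        (E' := ℝ × EuclideanSpace ℝ (Fin n)) (F' := ℝ × EuclideanSpace ℝ (Fin n))
        (innerSL ℝ) (dθ n p) (dθ n p)

theorem warpedMetric_apply (n : ℕ) (ψ : ℝ → ℝ) (p : ℝ × Sph n)
    (u v : TangentSpace (cylModel n) p) :
    warpedMetric n ψ p u v =
      dx n p u * dx n p v + ψ p.1 ^ 2 * inner ℝ (dθ n p u) (dθ n p v) := by
  change inner ℝ (dx n p u) (dx n p v) + ψ p.1 ^ 2 * inner ℝ (dθ n p u) (dθ n p v) = _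
  rw [real_inner_eq_re_inner]
  simp [mul_comm]

/-- `(W, X, Y)` solves, on the set `J` of values of `y`, the system
`W' = W (X² - lam W²)`, `X' = X³ - X + Y²/√n + lam (√n - X) W²`,
`Y' = Y (X² - X/√n - lam W²)`. -/
def IsSolution (n : ℕ) (lam : ℝ) (J : Set ℝ) (W X Y : ℝ → ℝ) : Prop :=
  ∀ y ∈ J,
    HasDerivWithinAt W (W y * (X y ^ 2 - lam * W y ^ 2)) J y ∧
    HasDerivWithinAt X
      (X y ^ 3 - X y + Y y ^ 2 / √(n : ℝ) + lam * (√(n : ℝ) - X y) * W y ^ 2) J y ∧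
    HasDerivWithinAt Y (Y y * (X y ^ 2 - X y / √(n : ℝ) - lam * W y ^ 2)) J y

end RicciSoliton

end

/-!
The point `(W, X, Y) = (0, 1, 0)` is an equilibrium of the system whose linearization has the
eigenvalues `1`, `2` and `1 - 1/√n`, all positive. So it is a source, and trajectories that start
near it exist for all negative times and converge to it exponentially as `y → -∞`. In detail,
`W² + (X - 1)² + Y²` grows at a definite rate inside a small ball (`exists_radius_source`), which
traps a backward trajectory of the field multiplied by a cutoff function in the region where the
cutoff is `1` (`exists_solution_near_source`). Uniqueness is the local Lipschitz property of the
field (`IsSolution.eqOn_Icc`), and `W`, `Y` stay positive as each solves a linear equation.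

Since `W` decays exponentially, `x(y) = ∫_{-∞}^y W` is finite and has a smooth inverse
`y = g(x)` (`exists_smooth_inverse`). Put `ψ = √(n(n-1)) W / Y` and let `φ` be an antiderivative of
`√n X - 1` in `y`, both read as functions of `x`; then `ψ' / ψ = X / (√n W)` and
`φ' = (√n X - 1) / W`, and the system turns into the two soliton equations
(`soliton_equations_of_isSolution`). All of this holds on a slightly longer interval than
`(-∞, 0]`, which gives smoothness up to `x = δ`.

The two ordinary differential equations are the radial and the spherical component of
`Ric + ∇∇φ + λ g = 0`. To see this, the warped product metric is read in the chart
`id × (stereographic projection)`, in which it is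
`dx² + ψ(x)² 16 / (‖w‖² + 4)² |dw|²` (`chartMetric_warped`). The Christoffel symbols of that metric
are explicit (`christoffel_warped`), and at `w = 0`, the image of the base point of the chart, so
are their derivatives, hence the Ricci tensor (`ricciCoord_warped`) and the Hessian
(`hessCoord_warped`).

For the asymptotics, `W / x → 1` by l'Hôpital's rule, as `W' / x' = X² - λ W² → 1`. The logarithmic
derivative of `ψ / W ^ (1 / √n)` in `y` decays exponentially, so that this quotient has a positive
limit (`tendsto_of_isSolution_of_decay`). Hence `ψ ~ a x ^ (1 / √n)`; as `1 / √n < 1`, the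
difference quotients of `ψ` at `0` are unbounded and `ψ` has no `C^1` extension.
-/

noncomputable section

namespace RicciSoliton

/-! ### Curvature of a warped product in conformally flat coordinates -/

section Coordinates

variable {V : Type*} [NormedAddCommGroup V] [InnerProductSpace ℝ V]

/-- The bilinear form `u₁ v₁ + c ⟨u₂, v₂⟩` on `ℝ × V`. -/
def splitForm (c : ℝ) : (ℝ × V) →L[ℝ] (ℝ × V) →L[ℝ] ℝ :=
  (innerSL ℝ : ℝ →L[ℝ] ℝ →L[ℝ] ℝ).bilinearComp (.fst ℝ ℝ V) (.fst ℝ ℝ V)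
    + c • (innerSL ℝ : V →L[ℝ] V →L[ℝ] ℝ).bilinearComp (.snd ℝ ℝ V) (.snd ℝ ℝ V)

theorem splitForm_apply (c : ℝ) (u v : ℝ × V) :
    splitForm c u v = u.1 * v.1 + c * inner ℝ u.2 v.2 := by
  simp [splitForm, mul_comm]

theorem fderiv_splitForm {F : ℝ × V → ℝ} {z : ℝ × V} (hF : DifferentiableAt ℝ F z)
    (h u v : ℝ × V) :
    fderiv ℝ (fun z => splitForm (V := V) (F z)) z h u v = fderiv ℝ F z h * inner ℝ u.2 v.2 := by
  have : HasFDerivAt (fun z => splitForm (V := V) (F z)) _ z :=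
    (hF.hasFDerivAt.smul_const
      ((innerSL ℝ : V →L[ℝ] V →L[ℝ] ℝ).bilinearComp (.snd ℝ ℝ V) (.snd ℝ ℝ V))).const_add _
  rw [this.fderiv]
  simp

theorem isInvertible_splitForm [FiniteDimensional ℝ V] {c : ℝ} (hc : 0 < c) :
    (splitForm (V := V) c).IsInvertible := by
  have hinj : Function.Injective (splitForm (V := V) c).toLinearMap := by
    rw [← LinearMap.ker_eq_bot, LinearMap.ker_eq_bot']
    intro u hu
    have h : splitForm c u u = 0 := by
      have := congrArg (fun l : (ℝ × V) →L[ℝ] ℝ => l u) hu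
      simpa using this
    rw [splitForm_apply, real_inner_self_eq_norm_sq] at h
    have h1 : u.1 = 0 := by nlinarith [sq_nonneg u.1, mul_nonneg hc.le (sq_nonneg ‖u.2‖)]
    have h2 : u.2 = 0 := by
      rw [h1] at h
      simpa [hc.ne'] using h
    exact Prod.ext h1 h2
  let L : (ℝ × V →L[ℝ] ℝ) ≃ₗ[ℝ] Module.Dual ℝ (ℝ × V) := LinearMap.toContinuousLinearMap.symm
  let e := LinearEquiv.ofInjectiveOfFinrankEq (splitForm (V := V) c).toLinearMap hinj
    (by rw [L.finrank_eq, Subspace.dual_finrank_eq])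
  exact ⟨e.toContinuousLinearEquiv, ContinuousLinearMap.ext fun _ => rfl⟩

/-- The Christoffel symbols of `dx² + F(x, w) |dw|²`, in terms of the gradient `(a, g)` of
`(1/2) log F`. -/
theorem christoffel_splitForm [FiniteDimensional ℝ V] {F : ℝ × V → ℝ} {z : ℝ × V}
    (hF : DifferentiableAt ℝ F z) (hpos : 0 < F z) {a : ℝ} {g : V}
    (hg : ∀ h : ℝ × V, fderiv ℝ F z h = 2 * F z * (a * h.1 + inner ℝ g h.2)) (u v : ℝ × V) :
    christoffel (fun z => splitForm (V := V) (F z)) z u v =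
      (-(F z * a) * inner ℝ u.2 v.2,
        (a * u.1 + inner ℝ g u.2) • v.2 + (a * v.1 + inner ℝ g v.2) • u.2
          - (inner ℝ u.2 v.2 : ℝ) • g) := by
  rw [christoffel_apply, ← (isInvertible_splitForm (V := V) hpos).inverse_apply_self
    (_, _ - _)]
  congr 1
  ext w
  all_goals
    simp [koszul_apply, fderiv_splitForm hF, splitForm_apply, hg, inner_add_left, inner_sub_left,
      inner_smul_left, real_inner_comm]
    try ring

theorem trace_prod_eq [FiniteDimensional ℝ V] (T : (ℝ × V) →ₗ[ℝ] (ℝ × V)) :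
    LinearMap.trace ℝ (ℝ × V) T =
      (T (1, 0)).1 + LinearMap.trace ℝ V (LinearMap.snd ℝ ℝ V ∘ₗ T ∘ₗ LinearMap.inr ℝ ℝ V) := by
  have h : T = (T ∘ₗ LinearMap.inl ℝ ℝ V) ∘ₗ LinearMap.fst ℝ ℝ V
      + (T ∘ₗ LinearMap.inr ℝ ℝ V) ∘ₗ LinearMap.snd ℝ ℝ V := by
    refine LinearMap.ext fun w => ?_
    simp [← map_add]
  conv_lhs => rw [h]
  rw [map_add, LinearMap.trace_comp_comm' (LinearMap.fst ℝ ℝ V),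
    LinearMap.trace_comp_comm' (LinearMap.snd ℝ ℝ V)]
  congr 1
  have : LinearMap.fst ℝ ℝ V ∘ₗ T ∘ₗ LinearMap.inl ℝ ℝ V = (T (1, 0)).1 • LinearMap.id := by
    ext; simp
  rw [this]; simp


/-- The Christoffel symbols `Γ(u, v)` at `z = (x, w)` of the metric
`dx² + ψ(x)² 16 / (‖w‖² + 4)² |dw|²`, in terms of `p = ψ' / ψ` and `q = ψ ψ'`. -/
def warpedChristoffel (p q : ℝ → ℝ) (z u v : ℝ × V) : ℝ × V :=
  (-(q z.1 * (16 / (‖z.2‖ ^ 2 + 4) ^ 2)) * inner ℝ u.2 v.2,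
    p z.1 • (u.1 • v.2 + v.1 • u.2)
      - (2 / (‖z.2‖ ^ 2 + 4)) • ((inner ℝ z.2 u.2 : ℝ) • v.2 + (inner ℝ z.2 v.2 : ℝ) • u.2
        - (inner ℝ u.2 v.2 : ℝ) • z.2))

theorem hasFDerivAt_roundFactor (z : ℝ × V) :
    HasFDerivAt (fun z : ℝ × V => 16 / (‖z.2‖ ^ 2 + 4) ^ 2)
      ((-64 / (‖z.2‖ ^ 2 + 4) ^ 3) • (innerSL ℝ z.2).comp (.snd ℝ ℝ V)) z := by
  have hs : (‖z.2‖ ^ 2 + 4) ≠ 0 := by positivity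
  have h1 : HasFDerivAt (fun z : ℝ × V => ‖z.2‖ ^ 2 + 4)
      (2 • (innerSL ℝ z.2).comp (.snd ℝ ℝ V)) z :=
    ((hasFDerivAt_snd (𝕜 := ℝ) (p := z)).norm_sq).add_const 4
  have h2 : HasDerivAt (fun s : ℝ => 16 / s ^ 2) (-32 / (‖z.2‖ ^ 2 + 4) ^ 3) (‖z.2‖ ^ 2 + 4) := by
    have := ((hasDerivAt_pow 2 (‖z.2‖ ^ 2 + 4)).inv (by positivity)).const_mul 16
    refine (this.congr_deriv ?_).congr_of_eventuallyEq (Eventually.of_forall fun s => ?_)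
    · field_simp; norm_num; ring
    · simp [div_eq_mul_inv]
  refine (h2.comp_hasFDerivAt z h1).congr_fderiv ?_
  ext
  · simp
  · simp; ring

theorem christoffel_warped [FiniteDimensional ℝ V] {ψ : ℝ → ℝ} {z : ℝ × V}
    (hψ : DifferentiableAt ℝ ψ z.1) (hpos : 0 < ψ z.1) (u v : ℝ × V) :
    christoffel (fun z => splitForm (V := V) (ψ z.1 ^ 2 * (16 / (‖z.2‖ ^ 2 + 4) ^ 2))) z u v =
      warpedChristoffel (fun x => deriv ψ x / ψ x) (fun x => ψ x * deriv ψ x) z u v := by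
  have hs : (‖z.2‖ ^ 2 + 4) ≠ 0 := by positivity
  have h1 : HasFDerivAt (fun z : ℝ × V => ψ z.1 ^ 2) _ z :=
    ((hψ.hasDerivAt.pow 2).comp_hasFDerivAt z (hasFDerivAt_fst (𝕜 := ℝ) (p := z)))
  have h2 : HasFDerivAt (fun z : ℝ × V => ψ z.1 ^ 2 * (16 / (‖z.2‖ ^ 2 + 4) ^ 2)) _ z :=
    h1.mul (hasFDerivAt_roundFactor z)
  rw [christoffel_splitForm (a := deriv ψ z.1 / ψ z.1) (g := (-2 / (‖z.2‖ ^ 2 + 4)) • z.2)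
    h2.differentiableAt (by positivity)]
  · simp only [warpedChristoffel, Prod.mk.injEq, inner_smul_left]
    constructor
    · field_simp
    · simp only [conj_trivial]
      module
  · intro h
    rw [h2.fderiv]
    simp [inner_smul_left]
    field_simp
    ring

theorem hasFDerivAt_warpedChristoffel {p q : ℝ → ℝ} {x p' q' : ℝ} (hp : HasDerivAt p p' x)
    (hq : HasDerivAt q q' x) (u v h : ℝ × V) :
    DifferentiableAt ℝ (fun z => warpedChristoffel p q z u v) ((x, 0) : ℝ × V) ∧
    fderiv ℝ (fun z => warpedChristoffel p q z u v) ((x, 0) : ℝ × V) h =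
      (-(q' * h.1) * inner ℝ u.2 v.2,
        (p' * h.1) • (u.1 • v.2 + v.1 • u.2)
          - (1 / 2 : ℝ) • ((inner ℝ h.2 u.2 : ℝ) • v.2 + (inner ℝ h.2 v.2 : ℝ) • u.2
            - (inner ℝ u.2 v.2 : ℝ) • h.2)) := by
  have hp1 : HasFDerivAt (fun z : ℝ × V => p z.1) _ ((x, 0) : ℝ × V) :=
    hp.comp_hasFDerivAt ((x, 0) : ℝ × V)
      (hasFDerivAt_fst (𝕜 := ℝ) (p := ((x, 0) : ℝ × V)))
  have hq1 : HasFDerivAt (fun z : ℝ × V => q z.1) _ ((x, 0) : ℝ × V) :=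
    hq.comp_hasFDerivAt ((x, 0) : ℝ × V)
      (hasFDerivAt_fst (𝕜 := ℝ) (p := ((x, 0) : ℝ × V)))
  have hs : HasFDerivAt (fun z : ℝ × V => 2 / (‖z.2‖ ^ 2 + 4)) (0 : ℝ × V →L[ℝ] ℝ)
      ((x, 0) : ℝ × V) := by
    have h1 : HasFDerivAt (fun z : ℝ × V => ‖z.2‖ ^ 2 + 4) _ ((x, 0) : ℝ × V) :=
      ((hasFDerivAt_snd (𝕜 := ℝ)).norm_sq).add_const 4
    have h2 : HasDerivAt (fun s : ℝ => 2 * s⁻¹) _ (‖((x, 0) : ℝ × V).2‖ ^ 2 + 4) :=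
      (hasDerivAt_inv (by positivity)).const_mul 2
    refine ((h2.comp_hasFDerivAt ((x, 0) : ℝ × V) h1).congr_fderiv ?_).congr_of_eventuallyEq
      (Eventually.of_forall fun z => ?_)
    · ext <;> simp
    · simp [div_eq_mul_inv]
  have hin (a : V) : HasFDerivAt (fun z : ℝ × V => (inner ℝ z.2 a : ℝ))
      ((innerSL ℝ a).comp (.snd ℝ ℝ V)) ((x, 0) : ℝ × V) := by
    simp_rw [real_inner_comm a]
    exact ((innerSL ℝ a).comp (.snd ℝ ℝ V)).hasFDerivAt
  have hfst := ((hq1.mul (hasFDerivAt_roundFactor ((x, 0) : ℝ × V))).neg.mul_const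
    (inner ℝ u.2 v.2))
  have hsnd := (hp1.smul_const (u.1 • v.2 + v.1 • u.2)).sub
    (hs.smul ((((hin u.2).smul_const v.2).add ((hin v.2).smul_const u.2)).sub
      ((hasFDerivAt_snd (𝕜 := ℝ)).const_smul (inner ℝ u.2 v.2 : ℝ))))
  have H : HasFDerivAt (fun z => warpedChristoffel p q z u v) _ ((x, 0) : ℝ × V) := hfst.prodMk hsnd
  refine ⟨H.differentiableAt, ?_⟩
  rw [H.fderiv]
  simp [real_inner_comm]
  norm_num
  ring


/-- The Ricci tensor of `dx² + ψ(x)² 16 / (‖w‖² + 4)² |dw|²` at the points with `w = 0`. Only these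
are needed: the chart at a point of the sphere sends that point to `0`. -/
theorem ricciCoord_warped [FiniteDimensional ℝ V] {ψ : ℝ → ℝ} {J : Set ℝ} (hJ : IsOpen J)
    (hψ : ContDiffOn ℝ ∞ ψ J) (hpos : ∀ x ∈ J, 0 < ψ x) {x : ℝ} (hx : x ∈ J) (u v : ℝ × V) :
    ricciCoord (fun z => splitForm (V := V) (ψ z.1 ^ 2 * (16 / (‖z.2‖ ^ 2 + 4) ^ 2))) (x, 0) u v =
      -(Module.finrank ℝ V * (deriv (deriv ψ) x / ψ x)) * (u.1 * v.1)
        + (-(ψ x * deriv (deriv ψ) x) + (Module.finrank ℝ V - 1) * (1 - deriv ψ x ^ 2))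
          * inner ℝ u.2 v.2 := by
  have hdψ : ContDiffOn ℝ ∞ (deriv ψ) J := hψ.deriv_of_isOpen hJ (by norm_num)
  have hψx : HasDerivAt ψ (deriv ψ x) x :=
    ((hψ.contDiffAt (hJ.mem_nhds hx)).differentiableAt (by norm_num)).hasDerivAt
  have hdψx : HasDerivAt (deriv ψ) (deriv (deriv ψ) x) x :=
    ((hdψ.contDiffAt (hJ.mem_nhds hx)).differentiableAt (by norm_num)).hasDerivAt
  have h0 : ψ x ≠ 0 := (hpos x hx).ne'
  set G : ℝ × V → (ℝ × V) →L[ℝ] (ℝ × V) →L[ℝ] ℝ :=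
    fun z => splitForm (V := V) (ψ z.1 ^ 2 * (16 / (‖z.2‖ ^ 2 + 4) ^ 2))
  set p : ℝ → ℝ := fun x => deriv ψ x / ψ x
  set q : ℝ → ℝ := fun x => ψ x * deriv ψ x
  set p' : ℝ := (deriv (deriv ψ) x * ψ x - deriv ψ x * deriv ψ x) / ψ x ^ 2
  set q' : ℝ := deriv ψ x * deriv ψ x + ψ x * deriv (deriv ψ) x
  have hp : HasDerivAt p p' x := hdψx.div hψx h0
  have hq : HasDerivAt q q' x := hψx.mul hdψx
  have hS : IsOpen (Prod.fst ⁻¹' J : Set (ℝ × V)) := hJ.preimage continuous_fst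
  have hΓ (z : ℝ × V) (hz : z ∈ (Prod.fst ⁻¹' J : Set (ℝ × V))) (u v : ℝ × V) :
      christoffel G z u v = warpedChristoffel p q z u v :=
    christoffel_warped ((hψ.contDiffAt (hJ.mem_nhds hz)).differentiableAt (by norm_num))
      (hpos _ hz) u v
  have hd : ∀ h u v : ℝ × V, fderiv ℝ (christoffel G) (x, 0) h u v =
      fderiv ℝ (fun z => warpedChristoffel p q z u v) ((x, 0) : ℝ × V) h := by
    intro h u v
    have hC : ContDiffOn ℝ 1 (christoffel G) (Prod.fst ⁻¹' J) := by
      refine contDiffOn_clm_apply.2 fun u => contDiffOn_clm_apply.2 fun v => ?_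
      refine ContDiffOn.congr ?_ fun z hz => hΓ z hz u v
      have h1 : ContDiffOn ℝ 1 (fun z : ℝ × V => p z.1) (Prod.fst ⁻¹' J) :=
        ((hdψ.div hψ fun x hx => (hpos x hx).ne').of_le (by norm_num)).comp
          contDiffOn_fst fun z hz => hz
      have h2 : ContDiffOn ℝ 1 (fun z : ℝ × V => q z.1) (Prod.fst ⁻¹' J) :=
        ((hψ.mul hdψ).of_le (by norm_num)).comp contDiffOn_fst fun z hz => hz
      have h3 : ContDiff ℝ 1 (fun z : ℝ × V => ‖z.2‖ ^ 2 + 4) :=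
        (contDiff_snd.norm_sq ℝ).add contDiff_const
      have h4 : ContDiff ℝ 1 (fun z : ℝ × V => 16 / (‖z.2‖ ^ 2 + 4) ^ 2) :=
        contDiff_const.div (h3.pow 2) fun z => by positivity
      have h5 : ContDiff ℝ 1 (fun z : ℝ × V => 2 / (‖z.2‖ ^ 2 + 4)) :=
        contDiff_const.div h3 fun z => by positivity
      have h6 (a : V) : ContDiff ℝ 1 (fun z : ℝ × V => (inner ℝ z.2 a : ℝ)) :=
        contDiff_snd.inner ℝ contDiff_const
      refine ((h2.mul h4.contDiffOn).neg.mul contDiffOn_const).prodMk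
        ((h1.smul contDiffOn_const).sub (h5.contDiffOn.smul (ContDiff.contDiffOn ?_)))
      exact (((h6 _).smul contDiff_const).add ((h6 _).smul contDiff_const)).sub
        (contDiff_const.smul contDiff_snd)
    have hx' : ((x, 0) : ℝ × V) ∈ (Prod.fst ⁻¹' J : Set (ℝ × V)) := hx
    have hCx : HasFDerivAt (christoffel G) _ (x, 0) :=
      ((hC.contDiffAt (hS.mem_nhds hx')).differentiableAt (by norm_num)).hasFDerivAt
    have h1 := (hCx.clm_apply (hasFDerivAt_const u _)).clm_apply (hasFDerivAt_const v _)
    have h2 : (fun z => christoffel G z u v) =ᶠ[𝓝 ((x, 0) : ℝ × V)]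
        fun z => warpedChristoffel p q z u v := by
      filter_upwards [hS.mem_nhds hx'] with z hz using hΓ z hz u v
    rw [← h2.fderiv_eq, h1.fderiv]
    simp
  have hx' : ((x, 0) : ℝ × V) ∈ (Prod.fst ⁻¹' J : Set (ℝ × V)) := hx
  have hR (w : ℝ × V) := curvature_apply G (x, 0) u v w
  simp only [hd, (hasFDerivAt_warpedChristoffel hp hq _ _ _).2, hΓ _ hx'] at hR
  -- The trace splits into the `x` component `hR1` and the trace over `V`; on `V` the curvature
  -- endomorphism `hR2` is a multiple of the identity plus a rank one map.
  have hR1 : (curvature G (x, 0) u v (1, 0)).1 = (p x * q x - q') * inner ℝ u.2 v.2 := by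
    rw [hR]
    simp [warpedChristoffel, inner_smul_right]
    norm_num
    ring
  have hR2 : LinearMap.snd ℝ ℝ V ∘ₗ (curvature G (x, 0) u v : (ℝ × V) →ₗ[ℝ] (ℝ × V))
      ∘ₗ LinearMap.inr ℝ ℝ V =
      ((1 - p x * q x) * inner ℝ u.2 v.2 - (p' + p x ^ 2) * (u.1 * v.1)) • LinearMap.id
        + (p x * q x - 1) • (InnerProductSpace.rankOne ℝ u.2 v.2 : V →ₗ[ℝ] V) := by
    ext w
    simp [hR, warpedChristoffel, real_inner_comm]
    norm_num
    module
  rw [ricciCoord, trace_prod_eq, hR2]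
  simp only [ContinuousLinearMap.coe_coe, hR1, map_add, map_smul, LinearMap.trace_id,
    InnerProductSpace.trace_rankOne, smul_eq_mul, p, q, p', q', real_inner_comm]
  field_simp
  ring

theorem hessCoord_warped [FiniteDimensional ℝ V] {ψ φ : ℝ → ℝ} {J : Set ℝ} (hJ : IsOpen J)
    (hψ : ContDiffOn ℝ ∞ ψ J) (hpos : ∀ x ∈ J, 0 < ψ x) (hφ : ContDiffOn ℝ ∞ φ J)
    {x : ℝ} (hx : x ∈ J) (u v : ℝ × V) :
    hessCoord (fun z => splitForm (V := V) (ψ z.1 ^ 2 * (16 / (‖z.2‖ ^ 2 + 4) ^ 2)))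
        (fun z => φ z.1) (x, 0) u v =
      deriv (deriv φ) x * (u.1 * v.1) + deriv φ x * (ψ x * deriv ψ x) * inner ℝ u.2 v.2 := by
  have hdφ : ContDiffOn ℝ ∞ (deriv φ) J := hφ.deriv_of_isOpen hJ (by norm_num)
  have hφ' (y : ℝ) (hy : y ∈ J) : HasDerivAt φ (deriv φ y) y :=
    ((hφ.contDiffAt (hJ.mem_nhds hy)).differentiableAt (by norm_num)).hasDerivAt
  have hdφ' : HasDerivAt (deriv φ) (deriv (deriv φ) x) x :=
    ((hdφ.contDiffAt (hJ.mem_nhds hx)).differentiableAt (by norm_num)).hasDerivAt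
  have h1 (z : ℝ × V) (hz : z.1 ∈ J) :
      fderiv ℝ (fun z : ℝ × V => φ z.1) z = deriv φ z.1 • .fst ℝ ℝ V :=
    ((hφ' _ hz).comp_hasFDerivAt z (hasFDerivAt_fst (𝕜 := ℝ) (p := z))).fderiv
  have h2 : fderiv ℝ (fun z : ℝ × V => φ z.1) =ᶠ[𝓝 ((x, 0) : ℝ × V)]
      fun z => deriv φ z.1 • .fst ℝ ℝ V := by
    filter_upwards [(hJ.preimage continuous_fst).mem_nhds
      (show ((x, 0) : ℝ × V) ∈ Prod.fst ⁻¹' J from hx)] with z hz using h1 z hz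
  have h3 := (hdφ'.comp_hasFDerivAt ((x, 0) : ℝ × V)
    (hasFDerivAt_fst (𝕜 := ℝ) (p := ((x, 0) : ℝ × V)))).smul_const (ContinuousLinearMap.fst ℝ ℝ V)
  have h4 : fderiv ℝ (fun z : ℝ × V => deriv φ z.1 • ContinuousLinearMap.fst ℝ ℝ V) (x, 0) = _ :=
    h3.fderiv
  have h5 := christoffel_warped (V := V) (z := (x, 0))
    ((hψ.contDiffAt (hJ.mem_nhds hx)).differentiableAt (by norm_num)) (hpos _ hx) u v
  rw [hessCoord, h2.fderiv_eq, h1 _ hx, h5, h4]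
  simp [warpedChristoffel]
  norm_num
  ring

end Coordinates

/-! ### The warped product metric on `ℝ × S^n` in stereographic charts -/

/-- The inverse of the stereographic chart of the unit sphere at `θ`, as a map into the ambient
Euclidean space. -/
def invStereo (n : ℕ) (θ : Sph n) (w : EuclideanSpace ℝ (Fin n)) : EuclideanSpace ℝ (Fin (n + 1)) :=
  ((chartAt (EuclideanSpace ℝ (Fin n)) θ).symm w : Sph n)

/-- The chart at `θ` is the stereographic projection from `N = -θ`, followed by a linear isometry
of the orthogonal complement of `N` with the model space; `U` is the inverse of that isometry. -/
theorem exists_invStereo_eq (n : ℕ) (θ : Sph n) :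
    ∃ (N : EuclideanSpace ℝ (Fin (n + 1)))
      (U : EuclideanSpace ℝ (Fin n) →ₗᵢ[ℝ] EuclideanSpace ℝ (Fin (n + 1))), ‖N‖ = 1 ∧
      (∀ w, inner ℝ (U w) N = (0 : ℝ)) ∧ (∀ w, inner ℝ N (U w) = (0 : ℝ)) ∧
      ∀ w, invStereo n θ w =
        (‖w‖ ^ 2 + 4)⁻¹ • ((4 : ℝ) • U w + (‖w‖ ^ 2 - 4) • N) := by
  have : Fact (Module.finrank ℝ (EuclideanSpace ℝ (Fin (n + 1))) = n + 1) :=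
    ⟨finrank_euclideanSpace_fin⟩
  let U' := (OrthonormalBasis.fromOrthogonalSpanSingleton (𝕜 := ℝ) n
    (ne_zero_of_mem_unit_sphere (-θ))).repr
  let U := (Submodule.subtypeₗᵢ _).comp U'.symm.toLinearIsometry
  have hU (w) : inner ℝ (U w) ((-θ : Sph n) : EuclideanSpace ℝ (Fin (n + 1))) = (0 : ℝ) :=
    (Submodule.mem_orthogonal_singleton_iff_inner_left).1 (U'.symm w).2
  refine ⟨(-θ : Sph n), U, ?_, hU, fun w => by rw [real_inner_comm]; exact hU w, fun w => ?_⟩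
  · exact norm_eq_of_mem_sphere _
  · refine (stereographic'_symm_apply (-θ) w).trans ?_
    have : ‖(U'.symm w : EuclideanSpace ℝ (Fin (n + 1)))‖ = ‖w‖ :=
      U.norm_map w
    simp only [this, smul_add, U']
    rfl

theorem hasFDerivAt_invStereo {n : ℕ} {θ : Sph n} {N : EuclideanSpace ℝ (Fin (n + 1))}
    {U : EuclideanSpace ℝ (Fin n) →ₗᵢ[ℝ] EuclideanSpace ℝ (Fin (n + 1))}
    (h : ∀ w, invStereo n θ w = (‖w‖ ^ 2 + 4)⁻¹ • ((4 : ℝ) • U w + (‖w‖ ^ 2 - 4) • N))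
    (w : EuclideanSpace ℝ (Fin n)) :
    HasFDerivAt (invStereo n θ)
      ((-2 / (‖w‖ ^ 2 + 4) ^ 2) • (innerSL ℝ w).smulRight ((4 : ℝ) • U w - (8 : ℝ) • N)
        + (4 / (‖w‖ ^ 2 + 4)) • U.toContinuousLinearMap) w := by
  have hs : (‖w‖ ^ 2 + 4) ≠ 0 := by positivity
  have h1 : HasFDerivAt (fun z : EuclideanSpace ℝ (Fin n) => ‖z‖ ^ 2) (2 • innerSL ℝ w) w :=
    (hasFDerivAt_id w).norm_sq
  have h2 : HasFDerivAt (fun w => (‖w‖ ^ 2 + 4)⁻¹ • ((4 : ℝ) • U w + (‖w‖ ^ 2 - 4) • N)) _ w :=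
    ((hasDerivAt_inv hs).comp_hasFDerivAt w (h1.add_const 4)).smul
    ((U.toContinuousLinearMap.hasFDerivAt.const_smul (4 : ℝ)).add ((h1.sub_const 4).smul_const N))
  refine (h2.congr_fderiv ?_).congr_of_eventuallyEq (Eventually.of_forall h)
  ext1 a
  simp
  match_scalars <;> field_simp
  ring

theorem differentiableAt_invStereo (n : ℕ) (θ : Sph n) (w : EuclideanSpace ℝ (Fin n)) :
    DifferentiableAt ℝ (invStereo n θ) w := by
  obtain ⟨N, U, -, -, -, h⟩ := exists_invStereo_eq n θ
  exact (hasFDerivAt_invStereo h w).differentiableAt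

/-- The stereographic chart is conformal. -/
theorem inner_fderiv_invStereo (n : ℕ) (θ : Sph n) (w a b : EuclideanSpace ℝ (Fin n)) :
    inner ℝ (fderiv ℝ (invStereo n θ) w a) (fderiv ℝ (invStereo n θ) w b) =
      16 / (‖w‖ ^ 2 + 4) ^ 2 * inner ℝ a b := by
  obtain ⟨N, U, hN, hU, hUN, h⟩ := exists_invStereo_eq n θ
  have hs : (‖w‖ ^ 2 + 4) ≠ 0 := by positivity
  rw [(hasFDerivAt_invStereo h w).fderiv]
  have hUU (a b) : inner ℝ (U a) (U b) = (inner ℝ a b : ℝ) := U.inner_map_map a b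
  simp [inner_add_left, inner_add_right, inner_sub_left, inner_sub_right, inner_smul_left,
    inner_smul_right, hUU, hU, hUN, hN, real_inner_comm]
  field_simp
  ring

theorem extChartAt_cyl_symm_apply (n : ℕ) (p : ℝ × Sph n) (z : ℝ × EuclideanSpace ℝ (Fin n)) :
    (extChartAt (cylModel n) p).symm z =
      (z.1, (chartAt (EuclideanSpace ℝ (Fin n)) p.2).symm z.2) := by
  rw [extChartAt_prod]
  rfl

theorem extChartAt_cyl_target (n : ℕ) (p : ℝ × Sph n) :
    (extChartAt (cylModel n) p).target = univ := by
  have : Fact (Module.finrank ℝ (EuclideanSpace ℝ (Fin (n + 1))) = n + 1) :=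
    ⟨finrank_euclideanSpace_fin⟩
  have h : (chartAt (EuclideanSpace ℝ (Fin n)) p.2).target = univ := stereographic'_target (-p.2)
  rw [extChartAt_prod]
  refine (PartialEquiv.prod_target _ _).trans ?_
  have h' : (extChartAt (𝓡 n) p.2).target = univ := by simp [extChartAt, h]
  have h'' : (extChartAt 𝓘(ℝ, ℝ) p.1).target = univ := by
    simp only [mfld_simps]
    rw [chartAt_self_eq]
    rfl
  rw [h', h'', univ_prod_univ]

theorem extChartAt_cyl_self (n : ℕ) (p : ℝ × Sph n) :
    extChartAt (cylModel n) p p = (p.1, 0) := by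
  have : Fact (Module.finrank ℝ (EuclideanSpace ℝ (Fin (n + 1))) = n + 1) :=
    ⟨finrank_euclideanSpace_fin⟩
  have h : chartAt (EuclideanSpace ℝ (Fin n)) p.2 p.2 = 0 := by
    change (OrthonormalBasis.fromOrthogonalSpanSingleton (𝕜 := ℝ) n
      (ne_zero_of_mem_unit_sphere (-p.2))).repr
        (stereographic (norm_eq_of_mem_sphere (-p.2)) p.2) = 0
    rw [stereographic_neg_apply, map_zero]
  rw [extChartAt_prod]
  exact Prod.ext rfl h

theorem mdifferentiableAt_extChartAt_cyl_symm (n : ℕ) (p : ℝ × Sph n)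
    (z : ℝ × EuclideanSpace ℝ (Fin n)) :
    MDifferentiableAt 𝓘(ℝ, ℝ × EuclideanSpace ℝ (Fin n)) (cylModel n)
      (extChartAt (cylModel n) p).symm z := by
  refine ((contMDiffOn_extChartAt_symm (I := cylModel n) (n := 1) p).mdifferentiableOn
    (by norm_num)).mdifferentiableAt ?_
  rw [extChartAt_cyl_target]; exact univ_mem

theorem dx_mfderiv (n : ℕ) (p : ℝ × Sph n) (z u : ℝ × EuclideanSpace ℝ (Fin n)) :
    dx n ((extChartAt (cylModel n) p).symm z)
      (mfderiv 𝓘(ℝ, ℝ × EuclideanSpace ℝ (Fin n)) (cylModel n)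
        (extChartAt (cylModel n) p).symm z u) = u.1 := by
  have h := mfderiv_comp (I := 𝓘(ℝ, ℝ × EuclideanSpace ℝ (Fin n))) (I' := cylModel n)
    (I'' := 𝓘(ℝ, ℝ)) z
    (g := fun q : ℝ × Sph n => q.1) (mdifferentiableAt_fst)
    (mdifferentiableAt_extChartAt_cyl_symm n p z)
  have h' : (fun q : ℝ × Sph n => q.1) ∘ (extChartAt (cylModel n) p).symm = Prod.fst := by
    funext z; exact congrArg Prod.fst (extChartAt_cyl_symm_apply n p z)
  rw [h', mfderiv_eq_fderiv, fderiv_fst] at h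
  exact (congrArg (fun T : (ℝ × EuclideanSpace ℝ (Fin n)) →L[ℝ] ℝ => T u) h).symm

theorem mdifferentiable_coe_snd (n : ℕ) :
    MDifferentiable (cylModel n) 𝓘(ℝ, EuclideanSpace ℝ (Fin (n + 1)))
      (fun q : ℝ × Sph n => (q.2 : EuclideanSpace ℝ (Fin (n + 1)))) :=
  have : Fact (Module.finrank ℝ (EuclideanSpace ℝ (Fin (n + 1))) = n + 1) :=
    ⟨finrank_euclideanSpace_fin⟩
  ((contMDiff_coe_sphere (m := 1) (n := n)).comp contMDiff_snd).mdifferentiable (by norm_num)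

theorem dθ_mfderiv (n : ℕ) (p : ℝ × Sph n) (z u : ℝ × EuclideanSpace ℝ (Fin n)) :
    dθ n ((extChartAt (cylModel n) p).symm z)
      (mfderiv 𝓘(ℝ, ℝ × EuclideanSpace ℝ (Fin n)) (cylModel n)
        (extChartAt (cylModel n) p).symm z u) = fderiv ℝ (invStereo n p.2) z.2 u.2 := by
  have h := mfderiv_comp (I := 𝓘(ℝ, ℝ × EuclideanSpace ℝ (Fin n))) (I' := cylModel n)
    (I'' := 𝓘(ℝ, EuclideanSpace ℝ (Fin (n + 1)))) z
    (g := fun q : ℝ × Sph n => (q.2 : EuclideanSpace ℝ (Fin (n + 1))))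
    (mdifferentiable_coe_snd n _)
    (mdifferentiableAt_extChartAt_cyl_symm n p z)
  have h' : (fun q : ℝ × Sph n => (q.2 : EuclideanSpace ℝ (Fin (n + 1)))) ∘
      (extChartAt (cylModel n) p).symm = invStereo n p.2 ∘ Prod.snd := by
    funext z
    exact congrArg (fun q : ℝ × Sph n => (q.2 : EuclideanSpace ℝ (Fin (n + 1))))
      (extChartAt_cyl_symm_apply n p z)
  have hd := (differentiableAt_invStereo n p.2 z.2).hasFDerivAt.comp z
    (hasFDerivAt_snd (𝕜 := ℝ) (p := z))
  rw [h', mfderiv_eq_fderiv, hd.fderiv] at h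
  exact (congrArg (fun T : (ℝ × EuclideanSpace ℝ (Fin n)) →L[ℝ] EuclideanSpace ℝ (Fin (n + 1)) =>
    T u) h).symm

/-- The warped product metric in the preferred chart at `p`. -/
theorem chartMetric_warped (n : ℕ) (ψ : ℝ → ℝ) (p : ℝ × Sph n) :
    chartMetric (cylModel n) (warpedMetric n ψ) p =
      fun z => splitForm (ψ z.1 ^ 2 * (16 / (‖z.2‖ ^ 2 + 4) ^ 2)) := by
  funext z
  refine ContinuousLinearMap.ext fun u => ContinuousLinearMap.ext fun v => ?_
  refine (warpedMetric_apply n ψ ((extChartAt (cylModel n) p).symm z) _ _).trans ?_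
  refine (congrArg₂ (· + ·) (congrArg₂ (· * ·) (dx_mfderiv n p z u) (dx_mfderiv n p z v))
    (congrArg₂ (· * ·) rfl
      (congrArg₂ (inner ℝ) (dθ_mfderiv n p z u) (dθ_mfderiv n p z v)))).trans ?_
  rw [inner_fderiv_invStereo, splitForm_apply, extChartAt_cyl_symm_apply]
  ring

/-- At the base point `p` of the chart the conformal factor is `1`, so the tangent space at `p`
carries the inner product `u₁ v₁ + ψ² ⟨u₂, v₂⟩`. -/
theorem warpedMetric_self (n : ℕ) (ψ : ℝ → ℝ) (p : ℝ × Sph n)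
    (u v : ℝ × EuclideanSpace ℝ (Fin n)) :
    warpedMetric n ψ p u v = u.1 * v.1 + ψ p.1 ^ 2 * inner ℝ u.2 v.2 := by
  have h1 : dx n p = ContinuousLinearMap.fst ℝ ℝ (EuclideanSpace ℝ (Fin n)) := mfderiv_fst
  have h2 : dθ n p = (fderiv ℝ (invStereo n p.2) 0).comp
      (.snd ℝ ℝ (EuclideanSpace ℝ (Fin n))) := by
    have h' : writtenInExtChartAt (cylModel n) 𝓘(ℝ, EuclideanSpace ℝ (Fin (n + 1))) p
        (fun q : ℝ × Sph n => (q.2 : EuclideanSpace ℝ (Fin (n + 1)))) =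
        invStereo n p.2 ∘ Prod.snd := by
      funext z
      exact congrArg (fun q : ℝ × Sph n => (q.2 : EuclideanSpace ℝ (Fin (n + 1))))
        (extChartAt_cyl_symm_apply n p z)
    have hd := (differentiableAt_invStereo n p.2 0).hasFDerivAt.comp ((p.1, 0) : ℝ × _)
      (hasFDerivAt_snd (𝕜 := ℝ) (p := ((p.1, 0) : ℝ × EuclideanSpace ℝ (Fin n))))
    refine (mdifferentiable_coe_snd n p).mfderiv.trans ?_
    rw [h', extChartAt_cyl_self, ModelWithCorners.range_eq_univ, fderivWithin_univ, hd.fderiv]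
  refine (warpedMetric_apply n ψ p _ _).trans ?_
  rw [h1, h2]
  refine congrArg₂ (· + ·) rfl (congrArg₂ (· * ·) rfl
    ((inner_fderiv_invStereo n p.2 0 u.2 v.2).trans ?_))
  norm_num

theorem ricci_warped (n : ℕ) {ψ : ℝ → ℝ} {J : Set ℝ} (hJ : IsOpen J) (hψ : ContDiffOn ℝ ∞ ψ J)
    (hpos : ∀ x ∈ J, 0 < ψ x) {p : ℝ × Sph n} (hp : p.1 ∈ J)
    (u v : ℝ × EuclideanSpace ℝ (Fin n)) :
    ricci (cylModel n) (warpedMetric n ψ) p u v =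
      -(n * (deriv (deriv ψ) p.1 / ψ p.1)) * (u.1 * v.1)
        + (-(ψ p.1 * deriv (deriv ψ) p.1) + (n - 1) * (1 - deriv ψ p.1 ^ 2))
          * inner ℝ u.2 v.2 := by
  have hR := ricciCoord_warped (V := EuclideanSpace ℝ (Fin n)) hJ hψ hpos hp u v
  rw [finrank_euclideanSpace_fin] at hR
  unfold ricci
  rw [chartMetric_warped, extChartAt_cyl_self]
  exact hR

theorem hessian_warped (n : ℕ) {ψ φ : ℝ → ℝ} {J : Set ℝ} (hJ : IsOpen J)
    (hψ : ContDiffOn ℝ ∞ ψ J) (hpos : ∀ x ∈ J, 0 < ψ x) (hφ : ContDiffOn ℝ ∞ φ J)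
    {p : ℝ × Sph n} (hp : p.1 ∈ J) (u v : ℝ × EuclideanSpace ℝ (Fin n)) :
    hessian (cylModel n) (warpedMetric n ψ) (fun p : ℝ × Sph n => φ p.1) p u v =
      deriv (deriv φ) p.1 * (u.1 * v.1)
        + deriv φ p.1 * (ψ p.1 * deriv ψ p.1) * inner ℝ u.2 v.2 := by
  have hf : (fun p : ℝ × Sph n => φ p.1) ∘ (extChartAt (cylModel n) p).symm = fun z => φ z.1 := by
    funext z; exact congrArg (fun q : ℝ × Sph n => φ q.1) (extChartAt_cyl_symm_apply n p z)
  unfold hessian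
  rw [chartMetric_warped, hf, extChartAt_cyl_self]
  exact hessCoord_warped (V := EuclideanSpace ℝ (Fin n)) hJ hψ hpos hφ hp u v

/-- For a warped product metric and a potential depending on `x` alone, the soliton equation
follows from its radial and its spherical component. -/
theorem isGradientSolitonOn_warped (n : ℕ) (lam : ℝ) {ψ φ : ℝ → ℝ} {J : Set ℝ} (hJ : IsOpen J)
    (hψ : ContDiffOn ℝ ∞ ψ J) (hpos : ∀ x ∈ J, 0 < ψ x) (hφ : ContDiffOn ℝ ∞ φ J)
    (h : ∀ x ∈ J, n * deriv (deriv ψ) x - ψ x * deriv (deriv φ) x = lam * ψ x ∧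
      ψ x * deriv (deriv ψ) x + (n - 1) * deriv ψ x ^ 2 - (n - 1) - ψ x * deriv ψ x * deriv φ x
        = lam * ψ x ^ 2) :
    IsGradientSolitonOn (cylModel n) (warpedMetric n ψ) (fun p : ℝ × Sph n => φ p.1) lam
      (J ×ˢ univ) := by
  rintro p ⟨hp, -⟩ (u : ℝ × EuclideanSpace ℝ (Fin n)) (v : ℝ × EuclideanSpace ℝ (Fin n))
  have h0 : ψ p.1 ≠ 0 := (hpos _ hp).ne'
  refine (congrArg₂ (· + ·) (congrArg₂ (· + ·) (ricci_warped n hJ hψ hpos hp u v)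
    (hessian_warped n hJ hψ hpos hφ hp u v))
    (congrArg (lam * ·) (warpedMetric_self n ψ p u v))).trans ?_
  have e1 : deriv (deriv φ) p.1 = n * (deriv (deriv ψ) p.1 / ψ p.1) - lam := by
    field_simp
    linear_combination -(h _ hp).1
  rw [e1]
  linear_combination -(inner ℝ u.2 v.2 : ℝ) * (h _ hp).2

/-! ### Autonomous differential equations -/

section ODE

variable {E : Type*} [NormedAddCommGroup E] [NormedSpace ℝ E]

open scoped NNReal in
/-- A bounded Lipschitz field is complete: by uniqueness, the Picard-Lindelöf solutions on growing
intervals around `0` fit together. -/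
theorem exists_global_solution_of_lipschitzWith [CompleteSpace E] {f : E → E} {K M : ℝ≥0}
    (hf : LipschitzWith K f) (hM : ∀ x, ‖f x‖ ≤ M) (x₀ : E) :
    ∃ γ : ℝ → E, γ 0 = x₀ ∧ ∀ t, HasDerivAt γ (f (γ t)) t := by
  have key (N : ℕ) : ∃ γ : ℝ → E, γ 0 = x₀ ∧ ∀ t ∈ Ioo (-(N + 1 : ℝ)) (N + 1),
      HasDerivAt γ (f (γ t)) t := by
    have h0 : (0 : ℝ) ∈ Icc (-(N + 1 : ℝ)) (N + 1) := ⟨by linarith [N.cast_nonneg (α := ℝ)],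
      by positivity⟩
    have hP : IsPicardLindelof (fun _ => f) (⟨0, h0⟩ : Icc (-(N + 1 : ℝ)) (N + 1)) x₀
        (M * (N + 1)) 0 M K :=
      .of_time_independent (fun x _ => hM x) (hf.lipschitzOnWith) (by simp)
    obtain ⟨γ, h1, h2⟩ := hP.exists_eq_forall_mem_Icc_hasDerivWithinAt₀
    exact ⟨γ, h1, fun t ht => (h2 t (Ioo_subset_Icc_self ht)).hasDerivAt
      (Icc_mem_nhds ht.1 ht.2)⟩
  choose γ h0 h using key
  have heq {N M : ℕ} (hNM : N ≤ M) : EqOn (γ N) (γ M) (Ioo (-(N + 1 : ℝ)) (N + 1)) := by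
    have hc : (N : ℝ) ≤ M := by exact_mod_cast hNM
    refine ODE_solution_unique_of_mem_Ioo (v := fun _ => f) (s := fun _ => univ) (K := K) (t₀ := 0)
      (fun t _ => hf.lipschitzOnWith) ⟨by linarith [N.cast_nonneg (α := ℝ)], by positivity⟩
      (fun t ht => ⟨h N t ht, mem_univ _⟩)
      (fun t ht => ⟨h M t ⟨by linarith [ht.1], by linarith [ht.2]⟩, mem_univ _⟩) ?_
    rw [h0, h0]
  have hmem (t : ℝ) : t ∈ Ioo (-(⌊|t|⌋₊ + 1 : ℝ)) (⌊|t|⌋₊ + 1) :=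
    abs_lt.1 (Nat.lt_floor_add_one |t|)
  refine ⟨fun t => γ ⌊|t|⌋₊ t, by simp [h0], fun t => ?_⟩
  refine (h _ t (hmem t)).congr_of_eventuallyEq ?_
  filter_upwards [Ioo_mem_nhds (hmem t).1 (hmem t).2] with s hs
  refine heq ?_ (hmem s)
  have : |s| < ⌊|t|⌋₊ + 1 := abs_lt.2 hs
  exact Nat.lt_succ_iff.1 ((Nat.floor_lt (abs_nonneg s)).2 (by exact_mod_cast this))

/-- A curve defined for all times that solves the equation of a `C^1` field `V` as long as it is in
a given ball: an integral curve of the product of `V` with a bump function equal to `1` there. -/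
theorem exists_solution_while_mem_closedBall [FiniteDimensional ℝ E] {V : E → E}
    (hV : ContDiff ℝ 1 V) (c : E) {R : ℝ} (hR : 0 < R) (x₀ : E) :
    ∃ γ : ℝ → E, γ 0 = x₀ ∧ Differentiable ℝ γ ∧
      ∀ t, γ t ∈ Metric.closedBall c R → HasDerivAt γ (V (γ t)) t := by
  let χ : ContDiffBump c := ⟨R, R + 1, hR, by linarith⟩
  have hχ : ContDiff ℝ 1 fun x => χ x • V x := χ.contDiff.smul hV
  have hsupp : HasCompactSupport fun x => χ x • V x := χ.hasCompactSupport.smul_right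
  obtain ⟨K, hK⟩ := hχ.lipschitzWith_of_hasCompactSupport hsupp (by norm_num)
  obtain ⟨M, hM⟩ := hχ.continuous.bounded_above_of_compact_support hsupp
  have : CompleteSpace E := FiniteDimensional.complete ℝ E
  obtain ⟨γ, h0, h⟩ := exists_global_solution_of_lipschitzWith (M := M.toNNReal) hK
    (fun x => (hM x).trans (Real.le_coe_toNNReal M)) x₀
  refine ⟨γ, h0, fun t => (h t).differentiableAt, fun t ht => ?_⟩
  have := h t
  rwa [χ.one_of_mem_closedBall ht, one_smul] at this

/-- Solutions of the equation of a smooth field are smooth, by bootstrapping. -/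
theorem contDiffOn_of_hasDerivAt_comp {V : E → E} {U : Set E} {γ : ℝ → E} {s : Set ℝ}
    (hV : ContDiffOn ℝ ∞ V U) (hs : IsOpen s) (hγ : ∀ t ∈ s, HasDerivAt γ (V (γ t)) t)
    (hU : MapsTo γ s U) : ContDiffOn ℝ ∞ γ s := by
  rw [contDiffOn_infty]
  intro k
  induction k with
  | zero => exact contDiffOn_zero.2 fun t ht => (hγ t ht).continuousAt.continuousWithinAt
  | succ k ih =>
    rw [Nat.cast_add, Nat.cast_one, contDiffOn_succ_iff_deriv_of_isOpen hs]
    refine ⟨fun t ht => (hγ t ht).differentiableAt.differentiableWithinAt, by simp, ?_⟩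
    exact ((hV.of_le (by exact_mod_cast le_top)).comp ih hU).congr fun t ht => (hγ t ht).deriv

theorem solution_unique_Icc [FiniteDimensional ℝ E] {V : E → E} (hV : ContDiff ℝ 1 V)
    {f g : ℝ → E} {T b : ℝ} (hf : ∀ t ∈ Icc T b, HasDerivWithinAt f (V (f t)) (Icc T b) t)
    (hg : ∀ t ∈ Icc T b, HasDerivWithinAt g (V (g t)) (Icc T b) t) (h : f b = g b) :
    EqOn f g (Icc T b) := by
  have hfc : ContinuousOn f (Icc T b) := fun t ht => (hf t ht).continuousWithinAt
  have hgc : ContinuousOn g (Icc T b) := fun t ht => (hg t ht).continuousWithinAt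
  have hK : IsCompact (f '' Icc T b ∪ g '' Icc T b) :=
    (isCompact_Icc.image_of_continuousOn hfc).union (isCompact_Icc.image_of_continuousOn hgc)
  obtain ⟨K, hL⟩ := (hV.locallyLipschitz.locallyLipschitzOn).exists_lipschitzOnWith_of_compact hK
  have hd {f : ℝ → E} (hf : ∀ t ∈ Icc T b, HasDerivWithinAt f (V (f t)) (Icc T b) t) (t : ℝ)
      (ht : t ∈ Ioc T b) : HasDerivWithinAt f (V (f t)) (Iic t) t :=
    ((hf t (Ioc_subset_Icc_self ht)).mono (Icc_subset_Icc_right ht.2)).mono_of_mem_nhdsWithin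
      (Icc_mem_nhdsLE ht.1)
  exact ODE_solution_unique_of_mem_Icc_left (v := fun _ => V) (s := fun _ => _)
    (fun _ _ => hL) hfc (hd hf) (fun t ht => .inl ⟨t, Ioc_subset_Icc_self ht, rfl⟩)
    hgc (hd hg) (fun t ht => .inr ⟨t, Ioc_subset_Icc_self ht, rfl⟩) h

theorem hasDerivAt_integral_of_continuous {h : ℝ → ℝ} (hh : Continuous h) (y : ℝ) :
    HasDerivAt (fun y => ∫ t in (0 : ℝ)..y, h t) (h y) y :=
  intervalIntegral.integral_hasDerivAt_right (hh.intervalIntegrable _ _)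
    (hh.stronglyMeasurableAtFilter _ _) hh.continuousAt

/-- A solution of a linear equation `f' = f h` that is positive at `0` remains positive. -/
theorem pos_of_hasDerivAt_mul {f h : ℝ → ℝ} {η : ℝ} (hη : 0 < η) (hh : Continuous h)
    (hf : ∀ y < η, HasDerivAt f (f y * h y) y) (h0 : 0 < f 0) {y : ℝ} (hy : y < η) : 0 < f y := by
  let H := fun y => ∫ t in (0 : ℝ)..y, h t
  have hd (y : ℝ) (hy : y ∈ Iio η) : HasDerivAt (fun y => f y * Real.exp (-H y)) 0 y :=
    ((hf y hy).mul (hasDerivAt_integral_of_continuous hh y).neg.exp).congr_deriv (by ring)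
  have hc := isOpen_Iio.is_const_of_deriv_eq_zero isPreconnected_Iio
    (fun y hy => (hd y hy).differentiableAt.differentiableWithinAt) (fun y hy => (hd y hy).deriv)
    (show y ∈ Iio η from hy) (show (0 : ℝ) ∈ Iio η from hη)
  have h1 : 0 < f y * Real.exp (-H y) := by
    rw [hc]; positivity
  exact pos_of_mul_pos_left h1 (Real.exp_pos _).le

end ODE

/-! ### The soliton system near its equilibrium -/

/-- The vector field of the soliton system on `ℝ³`. -/
def solitonField (n : ℕ) (lam : ℝ) (z : ℝ × ℝ × ℝ) : ℝ × ℝ × ℝ :=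
  (z.1 * (z.2.1 ^ 2 - lam * z.1 ^ 2),
    z.2.1 ^ 3 - z.2.1 + z.2.2 ^ 2 / √(n : ℝ) + lam * (√(n : ℝ) - z.2.1) * z.1 ^ 2,
    z.2.2 * (z.2.1 ^ 2 - z.2.1 / √(n : ℝ) - lam * z.1 ^ 2))

theorem contDiff_solitonField (n : ℕ) (lam : ℝ) {k : ℕ∞ω} : ContDiff ℝ k (solitonField n lam) := by
  unfold solitonField
  fun_prop

theorem hasDerivWithinAt_solitonField_iff {n : ℕ} {lam : ℝ} {J : Set ℝ} {W X Y : ℝ → ℝ} {y : ℝ} :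
    HasDerivWithinAt (fun y => (W y, X y, Y y)) (solitonField n lam (W y, X y, Y y)) J y ↔
      HasDerivWithinAt W (W y * (X y ^ 2 - lam * W y ^ 2)) J y ∧
      HasDerivWithinAt X
        (X y ^ 3 - X y + Y y ^ 2 / √(n : ℝ) + lam * (√(n : ℝ) - X y) * W y ^ 2) J y ∧
      HasDerivWithinAt Y (Y y * (X y ^ 2 - X y / √(n : ℝ) - lam * W y ^ 2)) J y := by
  constructor
  · intro h
    exact ⟨h.fst, h.snd.fst, h.snd.snd⟩
  · rintro ⟨h1, h2, h3⟩
    exact h1.prodMk (h2.prodMk h3)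

theorem isSolution_iff {n : ℕ} {lam : ℝ} {J : Set ℝ} {W X Y : ℝ → ℝ} :
    IsSolution n lam J W X Y ↔ ∀ y ∈ J,
      HasDerivWithinAt (fun y => (W y, X y, Y y)) (solitonField n lam (W y, X y, Y y)) J y := by
  simp only [hasDerivWithinAt_solitonField_iff, IsSolution]

theorem IsSolution.eqOn_Icc {n : ℕ} {lam T b : ℝ} {W X Y W' X' Y' : ℝ → ℝ}
    (h : IsSolution n lam (Icc T b) W X Y) (h' : IsSolution n lam (Icc T b) W' X' Y')
    (hW : W' b = W b) (hX : X' b = X b) (hY : Y' b = Y b) :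
    EqOn W' W (Icc T b) ∧ EqOn X' X (Icc T b) ∧ EqOn Y' Y (Icc T b) := by
  have H := solution_unique_Icc (contDiff_solitonField n lam) (isSolution_iff.1 h')
    (isSolution_iff.1 h) (by simp only [hW, hX, hY])
  exact ⟨fun y hy => congrArg Prod.fst (H hy), fun y hy => congrArg (·.2.1) (H hy),
    fun y hy => congrArg (·.2.2) (H hy)⟩

/-- The equilibrium `(0, 1, 0)` is a source: on a small ball around it, half the derivative of
`W² + (X - 1)² + Y²` along the field is bounded below by a positive multiple of that function. -/
theorem exists_radius_source {s lam : ℝ} (hs : 1 < s) :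
    ∃ r c : ℝ, 0 < r ∧ r ≤ 1 ∧ 0 < c ∧ ∀ W X Y : ℝ, W ^ 2 + (X - 1) ^ 2 + Y ^ 2 ≤ r ^ 2 →
      c * (W ^ 2 + (X - 1) ^ 2 + Y ^ 2) ≤
        W * (W * (X ^ 2 - lam * W ^ 2))
          + (X - 1) * (X ^ 3 - X + Y ^ 2 / s + lam * (s - X) * W ^ 2)
          + Y * (Y * (X ^ 2 - X / s - lam * W ^ 2)) := by
  have hs1 : 1 / s < 1 := (div_lt_one (by linarith)).2 hs
  have hs0 : 0 < 1 / s := by positivity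
  -- The linear part contributes at least `1 - 1 / s` times the sum of squares; on the ball of this
  -- radius the nonlinear part takes away at most half of that.
  obtain ⟨r, hr0, hr1, hr⟩ : ∃ r : ℝ, 0 < r ∧ r ≤ 1 ∧
      r * (4 + |lam| * (s + 3)) ≤ (1 - 1 / s) / 2 := by
    have hA : 0 < 4 + |lam| * (s + 3) := by positivity
    refine ⟨min 1 ((1 - 1 / s) / 2 / (4 + |lam| * (s + 3))), lt_min one_pos
      (div_pos (by linarith) hA), min_le_left _ _, ?_⟩
    exact (le_div_iff₀ hA).1 (min_le_right _ _)
  refine ⟨r, (1 - 1 / s) / 2, hr0, hr1, by linarith, fun W X Y h => ?_⟩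
  obtain ⟨a, rfl⟩ : ∃ a, X = 1 + a := ⟨X - 1, by ring⟩
  obtain ⟨t, ht⟩ : ∃ t, t = 1 / s := ⟨_, rfl⟩
  have hd (z : ℝ) : z / s = z * t := by rw [ht]; ring
  simp only [hd, one_mul] at hs1 hs0 hr ⊢
  simp only [add_sub_cancel_left] at h ⊢
  have hW2 : W ^ 2 ≤ r := by nlinarith [sq_nonneg a, sq_nonneg Y]
  have ha : |a| ≤ r := abs_le_of_sq_le_sq (by nlinarith [sq_nonneg W, sq_nonneg Y]) hr0.le
  obtain ⟨ha1, ha2⟩ := abs_le.1 ha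
  have hl : |lam * W ^ 2| ≤ |lam| * r := by
    rw [abs_mul, abs_of_nonneg (sq_nonneg W)]; gcongr
  have hl2 := (abs_le.1 hl).2
  have hla : |a * lam * (s - 1 - a)| ≤ r * |lam| * (s + 2) := by
    rw [abs_mul, abs_mul]
    gcongr
    rw [abs_le]; constructor <;> linarith
  have hla1 := (abs_le.1 hla).1
  have hl0 := mul_nonneg hr0.le (abs_nonneg lam)
  have hls : 0 ≤ r * |lam| * s := mul_nonneg hl0 (by linarith)
  have e1 : (1 - t) / 2 * W ^ 2 ≤ ((1 + a) ^ 2 - lam * W ^ 2 + a * lam * (s - 1 - a)) * W ^ 2 := by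
    gcongr; nlinarith [sq_nonneg a]
  have e2 : (1 - t) / 2 * a ^ 2 ≤ (2 + 3 * a + a ^ 2) * a ^ 2 := by
    gcongr; nlinarith [sq_nonneg a]
  have e3 : (1 - t) / 2 * Y ^ 2 ≤ ((1 + a) ^ 2 - (1 + a) * t - lam * W ^ 2 + a * t) * Y ^ 2 := by
    gcongr; nlinarith [sq_nonneg a]
  linear_combination e1 + e2 + e3

/-- Near the equilibrium, solutions exist on a neighbourhood of `(-∞, 0]` and converge to the
equilibrium exponentially as `y → -∞`. -/
theorem exists_solution_near_source {n : ℕ} (hn : 2 ≤ n) (lam : ℝ) :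
    ∃ ε c : ℝ, 0 < ε ∧ 0 < c ∧ ∀ W₀ X₀ Y₀ : ℝ, √(W₀ ^ 2 + (X₀ - 1) ^ 2 + Y₀ ^ 2) < ε →
      ∃ (W X Y : ℝ → ℝ) (η : ℝ), W 0 = W₀ ∧ X 0 = X₀ ∧ Y 0 = Y₀ ∧
        Continuous W ∧ Continuous X ∧ Continuous Y ∧ 0 < η ∧
        IsSolution n lam (Iio η) W X Y ∧
        ∀ y ≤ 0, |W y| ≤ Real.exp (c * y) ∧ |X y - 1| ≤ Real.exp (c * y) ∧
          |Y y| ≤ Real.exp (c * y) := by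
  have hs : 1 < √(n : ℝ) := by
    rw [Real.lt_sqrt zero_le_one]; norm_cast
  obtain ⟨r, c, hr0, hr1, hc, hsrc⟩ := exists_radius_source (lam := lam) hs
  refine ⟨r, c, hr0, hc, fun W₀ X₀ Y₀ h₀ => ?_⟩
  rw [Real.sqrt_lt' hr0] at h₀
  obtain ⟨γ, hγ0, hγd, hγ⟩ := exists_solution_while_mem_closedBall
    (contDiff_solitonField n lam) (0, 1, 0) one_pos (W₀, X₀, Y₀)
  set W : ℝ → ℝ := fun y => (γ y).1
  set X : ℝ → ℝ := fun y => (γ y).2.1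
  set Y : ℝ → ℝ := fun y => (γ y).2.2
  have hγc := hγd.continuous
  have hWc : Continuous W := hγc.fst
  have hXc : Continuous X := hγc.snd.fst
  have hYc : Continuous Y := hγc.snd.snd
  set U : ℝ → ℝ := fun y => W y ^ 2 + (X y - 1) ^ 2 + Y y ^ 2
  have hUc : Continuous U := by fun_prop
  have hU0 : U 0 < r ^ 2 := by simpa [U, W, X, Y, hγ0] using h₀
  have hsol (y : ℝ) (hy : U y ≤ r ^ 2) :
      HasDerivAt γ (solitonField n lam (γ y)) y := by
    refine hγ y ?_
    have hr2 : r ^ 2 ≤ 1 := by nlinarith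
    have h1 : |W y| ≤ 1 := (sq_le_one_iff_abs_le_one _).1
      (by nlinarith [sq_nonneg (X y - 1), sq_nonneg (Y y)])
    have h2 : |X y - 1| ≤ 1 := (sq_le_one_iff_abs_le_one _).1
      (by nlinarith [sq_nonneg (W y), sq_nonneg (Y y)])
    have h3 : |Y y| ≤ 1 := (sq_le_one_iff_abs_le_one _).1
      (by nlinarith [sq_nonneg (X y - 1), sq_nonneg (W y)])
    rw [mem_closedBall_iff_norm]
    simp [Prod.norm_def]
    exact ⟨h1, h2, h3⟩
  obtain ⟨U', hU', hU'c⟩ : ∃ U' : ℝ → ℝ, (∀ y, U y ≤ r ^ 2 → HasDerivAt U (U' y) y) ∧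
      ∀ y, U y ≤ r ^ 2 → 2 * c * U y ≤ U' y := by
    refine ⟨fun y => 2 * (W y * (solitonField n lam (γ y)).1
      + (X y - 1) * (solitonField n lam (γ y)).2.1 + Y y * (solitonField n lam (γ y)).2.2),
      fun y hy => ?_, fun y hy => ?_⟩
    · have h := hsol y hy
      have hW : HasDerivAt W _ y := h.fst
      have hX : HasDerivAt X _ y := h.snd.fst
      have hY : HasDerivAt Y _ y := h.snd.snd
      exact (((hW.pow 2).add ((hX.sub_const 1).pow 2)).add (hY.pow 2)).congr_deriv
        (by norm_num; ring)
    · have := hsrc _ _ _ hy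
      simp only [solitonField]
      linarith
  -- In reversed time `U` cannot cross the level `r²` upwards, as it decreases there.
  have htrap (y : ℝ) (hy : y ≤ 0) : U y ≤ r ^ 2 := by
    have hd (t : ℝ) : HasDerivAt (fun t => U (-t)) (-deriv U (-t)) t := by
      have hUd : DifferentiableAt ℝ U (-t) :=
        (((hγd _).fst.pow 2).add (((hγd _).snd.fst.sub_const 1).pow 2)).add ((hγd _).snd.snd.pow 2)
      exact ((hUd.hasDerivAt).scomp t (hasDerivAt_neg t)).congr_deriv (by simp)
    have := image_le_of_deriv_right_lt_deriv_boundary (f := fun t => U (-t)) (a := 0) (b := -y)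
      (B := fun _ => r ^ 2) (B' := fun _ => 0)
      (hUc.comp continuous_neg).continuousOn (fun t _ => (hd t).hasDerivWithinAt)
      (by simpa using hU0.le) (fun t => hasDerivAt_const t _)
      (fun t _ (ht : U (-t) = r ^ 2) => by
        rw [(hU' _ ht.le).deriv]
        have := hU'c _ ht.le
        rw [ht] at this
        nlinarith [mul_pos hc (pow_pos hr0 2)]) (x := -y) ⟨by linarith, le_rfl⟩
    simpa using this
  obtain ⟨η, hη, hηU⟩ : ∃ η > 0, ∀ y, |y| < η → U y < r ^ 2 := by
    have := Metric.eventually_nhds_iff.1 (hUc.continuousAt.eventually_lt continuousAt_const hU0)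
    simpa [Real.dist_eq] using this
  have hUη (y : ℝ) (hy : y < η) : U y ≤ r ^ 2 := by
    rcases le_or_gt y 0 with h | h
    · exact htrap y h
    · exact (hηU y (by rwa [abs_of_pos h])).le
  have hdecay (y : ℝ) (hy : y ≤ 0) : U y ≤ Real.exp (c * y) ^ 2 := by
    have hd (t : ℝ) (ht : t ≤ 0) : HasDerivAt (fun t => U t * Real.exp (-(2 * c * t)))
        ((U' t - 2 * c * U t) * Real.exp (-(2 * c * t))) t := by
      have := (hU' t (htrap t ht)).mul (((hasDerivAt_id t).const_mul (2 * c)).neg.exp)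
      exact this.congr_deriv (by simp; ring)
    have hmono : MonotoneOn (fun t => U t * Real.exp (-(2 * c * t))) (Iic 0) := by
      refine monotoneOn_of_hasDerivWithinAt_nonneg (convex_Iic 0)
        (f' := fun t => (U' t - 2 * c * U t) * Real.exp (-(2 * c * t)))
        (fun t ht => (hd t ht).continuousAt.continuousWithinAt) (fun t ht => ?_) (fun t ht => ?_)
      · exact (hd t (interior_subset (s := Iic (0 : ℝ)) ht)).hasDerivWithinAt
      · exact mul_nonneg
          (sub_nonneg.2 (hU'c t (htrap t (interior_subset (s := Iic (0 : ℝ)) ht))))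
          (Real.exp_pos _).le
    have h1 := hmono (show y ∈ Iic 0 from hy) (show (0 : ℝ) ∈ Iic 0 from self_mem_Iic) hy
    have h2 : U y * Real.exp (-(2 * c * y)) ≤ 1 := h1.trans (by simp; nlinarith)
    have h3 : Real.exp (c * y) ^ 2 * Real.exp (-(2 * c * y)) = 1 := by
      rw [← Real.exp_nat_mul, ← Real.exp_add]
      norm_num
      ring
    rw [← h3] at h2
    exact le_of_mul_le_mul_right h2 (Real.exp_pos _)
  refine ⟨W, X, Y, η, by simp [W, hγ0], by simp [X, hγ0], by simp [Y, hγ0], hWc, hXc, hYc, hη,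
    isSolution_iff.2 fun y hy => (hsol y (hUη y hy)).hasDerivWithinAt, fun y hy => ?_⟩
  have he := (Real.exp_pos (c * y)).le
  have hUy := hdecay y hy
  refine ⟨abs_le_of_sq_le_sq ?_ he, abs_le_of_sq_le_sq ?_ he, abs_le_of_sq_le_sq ?_ he⟩
  · nlinarith [sq_nonneg (X y - 1), sq_nonneg (Y y)]
  · nlinarith [sq_nonneg (W y), sq_nonneg (Y y)]
  · nlinarith [sq_nonneg (W y), sq_nonneg (X y - 1)]

/-! ### Calculus lemmas for the change of variable and for the end `x = 0` -/

/-- A function whose derivative decays exponentially at `-∞` has a limit there. -/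
theorem exists_tendsto_atBot_of_deriv_le_exp {f f' : ℝ → ℝ} {C c b : ℝ} (hc : 0 < c)
    (hf : ∀ y ≤ b, HasDerivAt f (f' y) y) (hf' : ContinuousOn f' (Iic b))
    (hb : ∀ y ≤ b, |f' y| ≤ C * Real.exp (c * y)) : ∃ l, Tendsto f atBot (𝓝 l) := by
  have hint : MeasureTheory.IntegrableOn f' (Iic b) := by
    refine MeasureTheory.Integrable.mono' ((integrableOn_exp_mul_Iic hc b).const_mul C)
      (hf'.aestronglyMeasurable measurableSet_Iic) ?_
    exact (MeasureTheory.ae_restrict_iff' measurableSet_Iic).2 (Eventually.of_forall hb)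
  exact ⟨_, MeasureTheory.tendsto_limUnder_of_hasDerivAt_of_integrableOn_Iic hf hint⟩

/-- The inverse `g` of an antiderivative `x` of a positive smooth function `W` on `(-∞, b)`. It is
smooth because it solves the equation `g' = 1 / W(g)`. -/
theorem exists_smooth_inverse {x W : ℝ → ℝ} {b : ℝ} (hx : ∀ y ≤ b, HasDerivAt x (W y) y)
    (hW : ∀ y ≤ b, 0 < W y) (hWs : ContDiffOn ℝ ∞ W (Iio b)) (h0 : Tendsto x atBot (𝓝 0)) :
    ∃ g : ℝ → ℝ, (∀ r ∈ Ioo 0 (x b), g r < b ∧ x (g r) = r ∧ HasDerivAt g (W (g r))⁻¹ r) ∧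
      (∀ y < b, x y ∈ Ioo 0 (x b) ∧ g (x y) = y) ∧ ContDiffOn ℝ ∞ g (Ioo 0 (x b)) ∧
      Tendsto g (𝓝[>] 0) atBot := by
  have hc : ContinuousOn x (Iic b) := fun y hy => (hx y hy).continuousAt.continuousWithinAt
  have hmono : StrictMonoOn x (Iic b) := by
    refine strictMonoOn_of_hasDerivWithinAt_pos (convex_Iic b) hc
      (fun y hy => (hx y (interior_subset (s := Iic b) hy)).hasDerivWithinAt)
      (fun y hy => hW y (interior_subset (s := Iic b) hy))
  have hpos (y : ℝ) (hy : y ≤ b) : 0 < x y := by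
    have h1 : 0 ≤ x (y - 1) := by
      refine le_of_tendsto h0 ?_
      filter_upwards [eventually_le_atBot (y - 1)] with t ht
      exact hmono.monotoneOn (by simp; linarith) (by simp; linarith) ht
    exact h1.trans_lt (hmono (by simp; linarith) hy (by linarith))
  have himg (y : ℝ) (hy : y < b) : x y ∈ Ioo 0 (x b) := ⟨hpos y hy.le, hmono hy.le self_mem_Iic hy⟩
  have hsurj (r : ℝ) (hr : r ∈ Ioo 0 (x b)) : ∃ y, y < b ∧ x y = r := by
    obtain ⟨a, ha, hab⟩ := ((h0.eventually (gt_mem_nhds hr.1)).and (eventually_le_atBot b)).exists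
    obtain ⟨y, hy, rfl⟩ := intermediate_value_Ioo hab (hc.mono Icc_subset_Iic_self) ⟨ha, hr.2⟩
    exact ⟨y, hy.2, rfl⟩
  choose! g hgb hgx using hsurj
  have hgi (y : ℝ) (hy : y < b) : g (x y) = y :=
    hmono.injOn (hgb _ (himg y hy)).le hy.le (hgx _ (himg y hy))
  have hgm : StrictMonoOn g (Ioo 0 (x b)) := by
    intro r hr t ht hrt
    rw [← hmono.lt_iff_lt (hgb r hr).le (hgb t ht).le, hgx r hr, hgx t ht]
    exact hrt
  have hgimg : g '' Ioo 0 (x b) = Iio b := by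
    ext y
    constructor
    · rintro ⟨r, hr, rfl⟩
      exact hgb r hr
    · intro hy
      exact ⟨x y, himg y hy, hgi y hy⟩
  have hgd (r : ℝ) (hr : r ∈ Ioo 0 (x b)) : HasDerivAt g (W (g r))⁻¹ r := by
    have hgc : ContinuousAt g r := hgm.continuousAt_of_image_mem_nhds (isOpen_Ioo.mem_nhds hr)
      (by rw [hgimg]; exact isOpen_Iio.mem_nhds (hgb r hr))
    refine HasDerivAt.of_local_left_inverse hgc (hx _ (hgb r hr).le) (hW _ (hgb r hr).le).ne' ?_
    filter_upwards [isOpen_Ioo.mem_nhds hr] with t ht using hgx t ht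
  refine ⟨g, fun r hr => ⟨hgb r hr, hgx r hr, hgd r hr⟩, fun y hy => ⟨himg y hy, hgi y hy⟩,
    contDiffOn_of_hasDerivAt_comp (V := fun y => (W y)⁻¹) (U := Iio b)
      (hWs.inv fun y hy => (hW y (le_of_lt hy)).ne') isOpen_Ioo hgd hgb, ?_⟩
  refine tendsto_atBot.2 fun M => ?_
  obtain ⟨y, hyM, hyb⟩ : ∃ y, y ≤ M ∧ y < b :=
    ⟨min M (b - 1), min_le_left _ _, (min_le_right _ _).trans_lt (by linarith)⟩
  filter_upwards [Ioo_mem_nhdsGT (himg y hyb).1] with r hr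
  have hr' : r ∈ Ioo 0 (x b) := ⟨hr.1, hr.2.trans (himg y hyb).2⟩
  have := hgm hr' (himg y hyb) hr.2
  rw [hgi y hyb] at this
  linarith

theorem tendsto_zero_of_isEquivalent_rpow {ψ : ℝ → ℝ} {a α : ℝ} (hα0 : 0 < α)
    (h : ψ ~[𝓝[>] 0] fun r => a * r ^ α) : Tendsto ψ (𝓝[>] 0) (𝓝 0) := by
  refine h.symm.tendsto_nhds ?_
  have : Tendsto (fun r : ℝ => a * r ^ α) (𝓝[>] 0) (𝓝 (a * 0 ^ α)) :=
    (((Real.continuousAt_rpow_const 0 α (.inr hα0.le)).tendsto).mono_left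
      nhdsWithin_le_nhds).const_mul a
  simpa [Real.zero_rpow hα0.ne'] using this

theorem exists_continuousOn_extension {ψ : ℝ → ℝ} {δ : ℝ} (hψ : ContinuousOn ψ (Ioo 0 δ))
    (h0 : Tendsto ψ (𝓝[>] 0) (𝓝 0)) :
    ∃ Ψ : ℝ → ℝ, ContinuousOn Ψ (Ico 0 δ) ∧ EqOn Ψ ψ (Ioo 0 δ) ∧ Ψ 0 = 0 := by
  have heq : EqOn (Function.update ψ 0 0) ψ (Ioo 0 δ) := fun r hr =>
    Function.update_of_ne hr.1.ne' _ _
  refine ⟨Function.update ψ 0 0, fun r hr => ?_, heq, Function.update_self _ _ _⟩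
  rcases hr.1.eq_or_lt with rfl | hr0
  · rw [continuousWithinAt_update_same]
    refine h0.mono_left (nhdsWithin_mono _ fun t ht => lt_of_le_of_ne ht.1.1 (Ne.symm ht.2))
  · have hnhds : Ioo 0 δ ∈ 𝓝 r := isOpen_Ioo.mem_nhds ⟨hr0, hr.2⟩
    refine ((hψ.continuousAt hnhds).congr ?_).continuousWithinAt
    filter_upwards [hnhds] with t ht using (heq ht).symm

/-- A function that behaves like `a r ^ α` with `0 < α < 1` has unbounded difference quotients at
`0`, so it has no `C^1` extension. -/
theorem not_exists_contDiffOn_extension {ψ : ℝ → ℝ} {a α δ : ℝ} (ha : 0 < a) (hα0 : 0 < α)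
    (hα : α < 1) (hδ : 0 < δ) (h : ψ ~[𝓝[>] 0] fun r => a * r ^ α) :
    ¬ ∃ Ψ : ℝ → ℝ, ContDiffOn ℝ 1 Ψ (Ico 0 δ) ∧ EqOn Ψ ψ (Ioo 0 δ) := by
  rintro ⟨Ψ, hΨ, heq⟩
  have h0 : (0 : ℝ) ∈ Ico 0 δ := ⟨le_rfl, hδ⟩
  have hIoo : Ioo 0 δ ∈ 𝓝[>] (0 : ℝ) := Ioo_mem_nhdsGT hδ
  have hψ0 := tendsto_zero_of_isEquivalent_rpow hα0 h
  have hΨ0 : Ψ 0 = 0 := by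
    have h1 : Tendsto Ψ (𝓝[>] 0) (𝓝 (Ψ 0)) :=
      (hΨ.continuousOn 0 h0).mono_left (nhdsWithin_le_of_mem (mem_of_superset hIoo
        Ioo_subset_Ico_self))
    refine tendsto_nhds_unique h1 (hψ0.congr' ?_)
    filter_upwards [hIoo] with r hr using (heq hr).symm
  have hd := ((hΨ.differentiableOn (by norm_num)) 0 h0).hasDerivWithinAt
  rw [hasDerivWithinAt_iff_tendsto_slope] at hd
  have h2 : Tendsto (fun r => ψ r / r) (𝓝[>] 0) (𝓝 (derivWithin Ψ (Ico 0 δ) 0)) := by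
    refine (hd.mono_left (nhdsWithin_le_of_mem ?_)).congr' ?_
    · filter_upwards [hIoo] with r hr using ⟨⟨hr.1.le, hr.2⟩, hr.1.ne'⟩
    · filter_upwards [hIoo] with r hr
      simp [slope_def_field, hΨ0, heq hr]
  have h3 : Tendsto (fun r => a * r ^ (α - 1)) (𝓝[>] 0) atTop :=
    (tendsto_rpow_neg_nhdsGT_zero (by linarith)).const_mul_atTop ha
  have h4 : (fun r => ψ r / r) ~[𝓝[>] 0] fun r => a * r ^ (α - 1) := by
    refine (h.div (IsEquivalent.refl (u := fun r : ℝ => r))).congr_right ?_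
    filter_upwards [self_mem_nhdsWithin] with r hr
    rw [Pi.div_apply, Real.rpow_sub_one (ne_of_gt hr), mul_div_assoc]
  exact not_tendsto_nhds_of_tendsto_atTop (h4.symm.tendsto_atTop h3) _ h2

/-! ### From the trajectory to the soliton -/

/-- A solution of the soliton system, read as a function of the arclength `x` with `dx = W dy`
(so `y = g(x)`), yields the two soliton equations for `ψ` and `φ`. -/
theorem soliton_equations_of_isSolution {n : ℕ} (hn : 2 ≤ n) {lam b : ℝ} {W X Y Φ g : ℝ → ℝ}
    {J : Set ℝ} (hJ : IsOpen J) (hsol : IsSolution n lam (Iio b) W X Y)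
    (hW : ∀ y < b, 0 < W y) (hY : ∀ y < b, 0 < Y y)
    (hΦ : ∀ y, HasDerivAt Φ (√(n : ℝ) * X y - 1) y)
    (hg : ∀ r ∈ J, g r < b ∧ HasDerivAt g (W (g r))⁻¹ r) {ψ φ : ℝ → ℝ}
    (hψ : ∀ r, ψ r = √((n : ℝ) * (n - 1)) * W (g r) / Y (g r)) (hφ : ∀ r, φ r = Φ (g r)) :
    ∀ r ∈ J,
      deriv ψ r = ψ r * (X (g r) / (√(n : ℝ) * W (g r))) ∧
      deriv φ r = (√(n : ℝ) * X (g r) - 1) / W (g r) ∧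
      n * deriv (deriv ψ) r - ψ r * deriv (deriv φ) r = lam * ψ r ∧
      ψ r * deriv (deriv ψ) r + (n - 1) * deriv ψ r ^ 2 - (n - 1)
        - ψ r * deriv ψ r * deriv φ r = lam * ψ r ^ 2 := by
  have hn' : (2 : ℝ) ≤ n := by exact_mod_cast hn
  obtain ⟨s, hsdef⟩ : ∃ s, s = √(n : ℝ) := ⟨_, rfl⟩
  have hs0 : 0 < s := by rw [hsdef]; positivity
  have hs2 : s ^ 2 = n := by rw [hsdef]; exact Real.sq_sqrt (by positivity)
  obtain ⟨k, hkdef⟩ : ∃ k, k = √((n : ℝ) * (n - 1)) := ⟨_, rfl⟩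
  have hk2 : k ^ 2 = s ^ 2 * (s ^ 2 - 1) := by
    rw [hkdef, hs2]
    exact Real.sq_sqrt (mul_nonneg (by linarith) (by linarith))
  simp only [IsSolution, ← hsdef, ← hkdef] at hsol hΦ hψ ⊢
  simp only [← hs2] at hn' ⊢
  obtain rfl : ψ = fun r => k * W (g r) / Y (g r) := funext hψ
  obtain rfl : φ = fun r => Φ (g r) := funext hφ
  have hd (f f' : ℝ → ℝ) (hf : ∀ y < b, HasDerivAt f (f' y) y) (r : ℝ) (hr : r ∈ J) :
      HasDerivAt (fun r => f (g r)) (f' (g r) * (W (g r))⁻¹) r :=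
    (hf _ (hg r hr).1).comp r (hg r hr).2
  have hdW := hd W _ fun y hy => ((hsol y hy).1).hasDerivAt (isOpen_Iio.mem_nhds hy)
  have hdX := hd X _ fun y hy => ((hsol y hy).2.1).hasDerivAt (isOpen_Iio.mem_nhds hy)
  have hdY := hd Y _ fun y hy => ((hsol y hy).2.2).hasDerivAt (isOpen_Iio.mem_nhds hy)
  have hdΦ := hd Φ _ fun y _ => hΦ y
  have hψ1 (r : ℝ) (hr : r ∈ J) : HasDerivAt (fun r => k * W (g r) / Y (g r))
      (k * W (g r) / Y (g r) * (X (g r) / (s * W (g r)))) r := by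
    have hW0 := (hW _ (hg r hr).1).ne'
    have hY0 := (hY _ (hg r hr).1).ne'
    refine (((hdW r hr).const_mul k).div (hdY r hr) hY0).congr_deriv ?_
    field_simp
    ring
  have hφ1 (r : ℝ) (hr : r ∈ J) : HasDerivAt (fun r => Φ (g r)) ((s * X (g r) - 1) / W (g r)) r :=
    (hdΦ r hr).congr_deriv (by rw [div_eq_mul_inv])
  intro r hr
  have hW0 := (hW _ (hg r hr).1).ne'
  have hY0 := (hY _ (hg r hr).1).ne'
  have hnhds := hJ.mem_nhds hr
  have hψ2 : HasDerivAt (deriv fun r => k * W (g r) / Y (g r)) _ r :=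
    ((hψ1 r hr).mul ((hdX r hr).div ((hdW r hr).const_mul s)
      (mul_ne_zero hs0.ne' hW0))).congr_of_eventuallyEq (by
        filter_upwards [hnhds] with t ht using (hψ1 t ht).deriv)
  have hφ2 : HasDerivAt (deriv fun r => Φ (g r)) _ r :=
    (((hdX r hr).const_mul s).sub_const 1 |>.div (hdW r hr) hW0).congr_of_eventuallyEq (by
        filter_upwards [hnhds] with t ht using (hφ1 t ht).deriv)
  refine ⟨(hψ1 r hr).deriv, (hφ1 r hr).deriv, ?_, ?_⟩
  · rw [hψ2.deriv, hφ2.deriv]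
    simp only [Pi.div_apply]
    field_simp
    ring
  · rw [hψ2.deriv, (hψ1 r hr).deriv, (hφ1 r hr).deriv]
    simp only [Pi.div_apply]
    field_simp
    linear_combination (Y (g r) ^ 2) * hk2

/-- The limits as `y → -∞` that determine the behaviour of the soliton at `x = 0`. -/
theorem tendsto_of_isSolution_of_decay {n : ℕ} {lam b c : ℝ} {W X Y x : ℝ → ℝ} (hb : 0 < b)
    (hc : 0 < c) (hWc : Continuous W) (hXc : Continuous X)
    (hsol : IsSolution n lam (Iio b) W X Y) (hW : ∀ y < b, 0 < W y) (hY : ∀ y < b, 0 < Y y)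
    (hdec : ∀ y ≤ 0, |W y| ≤ Real.exp (c * y) ∧ |X y - 1| ≤ Real.exp (c * y))
    (hx : ∀ y, HasDerivAt x (W y) y) (hx0 : Tendsto x atBot (𝓝 0)) :
    Tendsto X atBot (𝓝 1) ∧ Tendsto (fun y => W y / x y) atBot (𝓝 1) ∧
      ∃ a : ℝ, 0 < a ∧
        Tendsto (fun y => W y / Y y / W y ^ (1 / √(n : ℝ))) atBot (𝓝 a) := by
  have hexp : Tendsto (fun y => Real.exp (c * y)) atBot (𝓝 0) :=
    Real.tendsto_exp_atBot.comp (tendsto_id.const_mul_atBot hc)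
  have hWlim : Tendsto W atBot (𝓝 0) := squeeze_zero_norm'
    (by filter_upwards [eventually_le_atBot 0] with y hy using (hdec y hy).1) hexp
  have hXlim : Tendsto X atBot (𝓝 1) := by
    rw [← tendsto_sub_nhds_zero_iff]
    exact squeeze_zero_norm'
      (by filter_upwards [eventually_le_atBot 0] with y hy using (hdec y hy).2) hexp
  have hdW (y : ℝ) (hy : y < b) := ((hsol y hy).1).hasDerivAt (isOpen_Iio.mem_nhds hy)
  have hdY (y : ℝ) (hy : y < b) := ((hsol y hy).2.2).hasDerivAt (isOpen_Iio.mem_nhds hy)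
  refine ⟨hXlim, ?_, ?_⟩
  · refine HasDerivAt.lhopital_zero_atBot (f' := fun y => W y * (X y ^ 2 - lam * W y ^ 2))
      (g' := W) ?_ (Eventually.of_forall hx) ?_ hWlim hx0 ?_
    · filter_upwards [eventually_lt_atBot b] with y hy using hdW y hy
    · filter_upwards [eventually_lt_atBot b] with y hy using (hW y hy).ne'
    · have h1 : Tendsto (fun y => X y ^ 2 - lam * W y ^ 2) atBot (𝓝 (1 ^ 2 - lam * 0 ^ 2)) :=
        (hXlim.pow 2).sub ((hWlim.pow 2).const_mul lam)
      norm_num at h1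
      refine h1.congr' ?_
      filter_upwards [eventually_lt_atBot b] with y hy
      have := (hW y hy).ne'
      field_simp
  · obtain ⟨t, ht⟩ : ∃ t, t = 1 / √(n : ℝ) := ⟨_, rfl⟩
    rw [← ht]
    have hd (y : ℝ) (hy : y ≤ 0) :
        HasDerivAt (fun y => Real.log (W y / Y y / W y ^ t))
          (t * (lam * W y ^ 2 - X y * (X y - 1))) y := by
      have hy' : y < b := hy.trans_lt hb
      have h1 := ((hdW y hy').log (hW y hy').ne').const_mul (1 - t)
      refine ((h1.sub ((hdY y hy').log (hY y hy').ne')).congr_of_eventuallyEq ?_).congr_deriv ?_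
      · filter_upwards [isOpen_Iio.mem_nhds hy'] with z hz
        have hWz := hW z hz
        have hYz := hY z hz
        rw [Real.log_div (by positivity) (by positivity), Real.log_div hWz.ne' hYz.ne',
          Real.log_rpow hWz]
        simp only [Pi.sub_apply]
        ring
      · have := (hW y hy').ne'
        have := (hY y hy').ne'
        rw [div_eq_mul_one_div (X y), ← ht]
        field_simp
        ring
    obtain ⟨l, hl⟩ := exists_tendsto_atBot_of_deriv_le_exp hc (b := 0) (C := |t| * (|lam| + 2)) hd
      (by fun_prop) (fun y hy => by
        obtain ⟨h1, h2⟩ := hdec y hy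
        have he1 : Real.exp (c * y) ≤ 1 := Real.exp_le_one_iff.2 (by nlinarith)
        have hX2 : |X y| ≤ 2 := by
          have := abs_le.1 h2
          rw [abs_le]; constructor <;> linarith
        have hW2 : W y ^ 2 ≤ Real.exp (c * y) := by
          rw [← sq_abs]
          nlinarith [abs_nonneg (W y), Real.exp_pos (c * y)]
        rw [abs_mul, mul_assoc]
        gcongr
        refine (abs_sub _ _).trans ?_
        rw [abs_mul, abs_mul, abs_of_nonneg (sq_nonneg (W y)), add_mul]
        gcongr)
    refine ⟨Real.exp l, Real.exp_pos l, ((Real.continuous_exp.tendsto l).comp hl).congr' ?_⟩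
    filter_upwards [eventually_lt_atBot b] with y hy
    have := hW y hy
    have := hY y hy
    exact Real.exp_log (by positivity)

end RicciSoliton

end

theorem proposition2p1 (n : ℕ) (hn : 2 ≤ n) (lam : ℝ) :
    ∃ ε : ℝ, 0 < ε ∧ ∀ W₀ X₀ Y₀ : ℝ, 0 < W₀ → 0 < Y₀ →
      √(W₀ ^ 2 + (X₀ - 1) ^ 2 + Y₀ ^ 2) < ε →
      ∃ W X Y : ℝ → ℝ,
        -- the solution exists on `(-∞, 0]`
        RicciSoliton.IsSolution n lam (Iic 0) W X Y ∧ W 0 = W₀ ∧ X 0 = X₀ ∧ Y 0 = Y₀ ∧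
        -- it is unique, on every interval `[T, 0]`
        (∀ T : ℝ, T < 0 → ∀ W' X' Y' : ℝ → ℝ,
          RicciSoliton.IsSolution n lam (Icc T 0) W' X' Y' →
          W' 0 = W₀ → X' 0 = X₀ → Y' 0 = Y₀ →
          EqOn W' W (Icc T 0) ∧ EqOn X' X (Icc T 0) ∧ EqOn Y' Y (Icc T 0)) ∧
        (∀ y ≤ 0, 0 < W y ∧ 0 < Y y) ∧
        ∃ (δ : ℝ) (x ψ φ : ℝ → ℝ), 0 < δ ∧
          -- the change of variable `dx = W dy`, with `x → 0` as `y → -∞` and `x = δ` at `y = 0`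
          (∀ y ≤ 0, HasDerivWithinAt x (W y) (Iic 0) y) ∧ Tendsto x atBot (𝓝 0) ∧ x 0 = δ ∧
          -- `ψ` and `φ` are smooth on `(0, δ)`, smoothly up to `δ`
          ContDiffOn ℝ ∞ ψ (Ioc 0 δ) ∧ ContDiffOn ℝ ∞ φ (Ioc 0 δ) ∧
          (∀ r ∈ Ioc 0 δ, 0 < ψ r) ∧
          -- the trajectory corresponds to `ψ` and `ω = φ'`
          (∀ y < 0,
            W y = 1 / (-deriv φ (x y) + n * (deriv ψ (x y) / ψ (x y))) ∧
            X y = √(n : ℝ) * W y * (deriv ψ (x y) / ψ (x y)) ∧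
            Y y = √((n : ℝ) * (n - 1)) * W y / ψ (x y)) ∧
          -- the gradient Ricci soliton equation on `(0, δ) × S^n`
          RicciSoliton.IsGradientSolitonOn (RicciSoliton.cylModel n)
            (RicciSoliton.warpedMetric n ψ) (fun p : ℝ × RicciSoliton.Sph n => φ p.1) lam
            (Ioo 0 δ ×ˢ univ) ∧
          -- the equivalent system of ordinary differential equations
          (∀ r ∈ Ioo 0 δ,
            n * deriv (deriv ψ) r - ψ r * deriv (deriv φ) r = lam * ψ r ∧
            ψ r * deriv (deriv ψ) r + (n - 1) * deriv ψ r ^ 2 - (n - 1)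
              - ψ r * deriv ψ r * deriv φ r = lam * ψ r ^ 2) ∧
          -- the asymptotic profile as `x → 0⁺`
          (∃ a : ℝ, 0 < a ∧ ψ ~[𝓝[>] 0] fun r => a * r ^ (1 / √(n : ℝ))) ∧
          (deriv φ ~[𝓝[>] 0] fun r => (√(n : ℝ) - 1) / r) ∧
          -- `ψ` extends to `x = 0` continuously, with the value `0`, but not as a `C^1` function
          (∃ Ψ : ℝ → ℝ, ContinuousOn Ψ (Ico 0 δ) ∧ EqOn Ψ ψ (Ioo 0 δ) ∧ Ψ 0 = 0) ∧
          (¬ ∃ Ψ : ℝ → ℝ, ContDiffOn ℝ 1 Ψ (Ico 0 δ) ∧ EqOn Ψ ψ (Ioo 0 δ)) := by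
  obtain ⟨ε, c, hε, hc, H⟩ := RicciSoliton.exists_solution_near_source hn lam
  refine ⟨ε, hε, fun W₀ X₀ Y₀ hW₀ hY₀ h₀ => ?_⟩
  obtain ⟨W, X, Y, η, rfl, rfl, rfl, hWc, hXc, hYc, hη, hsol, hdec⟩ := H W₀ X₀ Y₀ h₀
  have hn' : (2 : ℝ) ≤ n := by exact_mod_cast hn
  have hs1 : 1 < √(n : ℝ) := by
    rw [Real.lt_sqrt zero_le_one]; linarith
  have hk : 0 < √((n : ℝ) * (n - 1)) := Real.sqrt_pos.2 (mul_pos (by linarith) (by linarith))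
  have hdW (y : ℝ) (hy : y < η) := ((hsol y hy).1).hasDerivAt (isOpen_Iio.mem_nhds hy)
  have hdY (y : ℝ) (hy : y < η) := ((hsol y hy).2.2).hasDerivAt (isOpen_Iio.mem_nhds hy)
  have hW (y : ℝ) (hy : y < η) : 0 < W y :=
    RicciSoliton.pos_of_hasDerivAt_mul hη (by fun_prop) hdW hW₀ hy
  have hY (y : ℝ) (hy : y < η) : 0 < Y y :=
    RicciSoliton.pos_of_hasDerivAt_mul hη (by fun_prop) hdY hY₀ hy
  have hsmooth : ContDiffOn ℝ ∞ (fun y => (W y, X y, Y y)) (Iio η) :=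
    RicciSoliton.contDiffOn_of_hasDerivAt_comp (U := univ)
      (RicciSoliton.contDiff_solitonField n lam).contDiffOn isOpen_Iio
      (fun y hy => (RicciSoliton.isSolution_iff.1 hsol y hy).hasDerivAt (isOpen_Iio.mem_nhds hy))
      (mapsTo_univ _ _)
  have hWs : ContDiffOn ℝ ∞ W (Iio η) := hsmooth.fst
  have hXs : ContDiffOn ℝ ∞ X (Iio η) := hsmooth.snd.fst
  have hYs : ContDiffOn ℝ ∞ Y (Iio η) := hsmooth.snd.snd
  -- the arclength `x`, an antiderivative of `W` normalized to vanish at `-∞`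
  obtain ⟨x, hx, hx0⟩ : ∃ x : ℝ → ℝ, (∀ y, HasDerivAt x (W y) y) ∧ Tendsto x atBot (𝓝 0) := by
    obtain ⟨m, hm⟩ := RicciSoliton.exists_tendsto_atBot_of_deriv_le_exp hc (b := 0) (C := 1)
      (fun y _ => RicciSoliton.hasDerivAt_integral_of_continuous hWc y) hWc.continuousOn
      (fun y hy => by simpa using (hdec y hy).1)
    exact ⟨_, fun y => (RicciSoliton.hasDerivAt_integral_of_continuous hWc y).sub_const m,
      tendsto_sub_nhds_zero_iff.2 hm⟩
  -- With `b` instead of `0` as the end point, `ψ` and `φ` are smooth on a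
  -- neighbourhood of `δ = x 0`.
  obtain ⟨b, hb0, hbη⟩ : ∃ b, 0 < b ∧ b < η := ⟨η / 2, by linarith, by linarith⟩
  have hIio : Iio b ⊆ Iio η := Iio_subset_Iio hbη.le
  obtain ⟨g, hg, hgx, hgs, hgbot⟩ := RicciSoliton.exists_smooth_inverse (b := b)
    (fun y _ => hx y) (fun y hy => hW y (hy.trans_lt hbη)) (hWs.mono hIio) hx0
  have hδ : x 0 ∈ Ioo 0 (x b) := (hgx 0 hb0).1
  have hIoc : Ioc 0 (x 0) ⊆ Ioo 0 (x b) := fun r hr => ⟨hr.1, hr.2.trans_lt hδ.2⟩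
  have hIoo : Ioo 0 (x 0) ⊆ Ioo 0 (x b) := Ioo_subset_Ioc_self.trans hIoc
  have hgmaps : MapsTo g (Ioo 0 (x b)) (Iio b) := fun r hr => (hg r hr).1
  -- the potential, as a function of `y`
  set Φ : ℝ → ℝ := fun y => ∫ t in (0 : ℝ)..y, (√(n : ℝ) * X t - 1)
  have hΦ (y : ℝ) : HasDerivAt Φ (√(n : ℝ) * X y - 1) y :=
    RicciSoliton.hasDerivAt_integral_of_continuous (by fun_prop) y
  have hΦs : ContDiffOn ℝ ∞ Φ (Iio b) := by
    refine (contDiffOn_infty_iff_deriv_of_isOpen isOpen_Iio).2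
      ⟨fun y _ => (hΦ y).differentiableAt.differentiableWithinAt, ?_⟩
    exact ((contDiffOn_const.mul (hXs.mono hIio)).sub contDiffOn_const).congr
      fun y _ => (hΦ y).deriv
  set ψ : ℝ → ℝ := fun r => √((n : ℝ) * (n - 1)) * W (g r) / Y (g r)
  set φ : ℝ → ℝ := fun r => Φ (g r)
  have hWb (y : ℝ) (hy : y < b) : 0 < W y := hW y (hy.trans hbη)
  have hYb (y : ℝ) (hy : y < b) : 0 < Y y := hY y (hy.trans hbη)
  have hsolb : RicciSoliton.IsSolution n lam (Iio b) W X Y := fun y hy =>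
    ⟨(hsol y (hIio hy)).1.mono hIio, (hsol y (hIio hy)).2.1.mono hIio,
      (hsol y (hIio hy)).2.2.mono hIio⟩
  have hψs : ContDiffOn ℝ ∞ ψ (Ioo 0 (x b)) :=
    (contDiffOn_const.mul ((hWs.mono hIio).comp hgs hgmaps)).div
      ((hYs.mono hIio).comp hgs hgmaps) fun r hr => (hYb _ (hgmaps hr)).ne'
  have hφs : ContDiffOn ℝ ∞ φ (Ioo 0 (x b)) := hΦs.comp hgs hgmaps
  have hψpos (r : ℝ) (hr : r ∈ Ioo 0 (x b)) : 0 < ψ r :=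
    div_pos (mul_pos hk (hWb _ (hgmaps hr))) (hYb _ (hgmaps hr))
  have heqs := RicciSoliton.soliton_equations_of_isSolution hn isOpen_Ioo hsolb hWb hYb hΦ
    (fun r hr => ⟨(hg r hr).1, (hg r hr).2.2⟩) (ψ := ψ) (φ := φ) (fun _ => rfl) (fun _ => rfl)
  obtain ⟨hXlim, hWx, a, ha, halim⟩ := RicciSoliton.tendsto_of_isSolution_of_decay hb0 hc hWc hXc
    hsolb hWb hYb (fun y hy => ⟨(hdec y hy).1, (hdec y hy).2.1⟩) hx hx0
  have hnear : ∀ᶠ r in 𝓝[>] (0 : ℝ), r ∈ Ioo 0 (x b) := Ioo_mem_nhdsGT (hδ.1.trans hδ.2)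
  have hψasymp : ψ ~[𝓝[>] 0] fun r => √((n : ℝ) * (n - 1)) * a * r ^ (1 / √(n : ℝ)) := by
    refine isEquivalent_of_tendsto_one ?_
    have h1 := ((halim.comp hgbot).mul (((hWx.comp hgbot).rpow_const
      (p := 1 / √(n : ℝ)) (.inl one_ne_zero)))).div_const a
    rw [Real.one_rpow, mul_one, div_self ha.ne'] at h1
    refine h1.congr' ?_
    filter_upwards [hnear] with r hr
    have hWr := hWb _ (hgmaps hr)
    have hYr := hYb _ (hgmaps hr)
    have hWp : 0 < W (g r) ^ (1 / √(n : ℝ)) := by positivity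
    have hrp : 0 < r ^ (1 / √(n : ℝ)) := Real.rpow_pos_of_pos hr.1 _
    simp only [Function.comp, Pi.div_apply, ψ, (hg r hr).2.1]
    rw [Real.div_rpow hWr.le hr.1.le]
    field_simp
  have hφasymp : deriv φ ~[𝓝[>] 0] fun r => (√(n : ℝ) - 1) / r := by
    refine isEquivalent_of_tendsto_one ?_
    have hs0 : √(n : ℝ) - 1 ≠ 0 := by linarith
    have h1 := (((((hXlim.comp hgbot).const_mul √(n : ℝ)).sub_const 1)).div_const
      (√(n : ℝ) - 1)).div (hWx.comp hgbot) one_ne_zero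
    rw [mul_one, div_self hs0, div_one] at h1
    refine h1.congr' ?_
    filter_upwards [hnear] with r hr
    have hWr := (hWb _ (hgmaps hr)).ne'
    have hr0 := hr.1.ne'
    simp only [Function.comp, Pi.div_apply, (heqs r hr).2.1, (hg r hr).2.1]
    field_simp
  have hα0 : 0 < 1 / √(n : ℝ) := by positivity
  have hα1 : 1 / √(n : ℝ) < 1 := (div_lt_one (by linarith)).2 hs1
  have hIic : Iic (0 : ℝ) ⊆ Iio η := Iic_subset_Iio.2 hη
  refine ⟨W, X, Y, fun y hy => ⟨(hsol y (hIic hy)).1.mono hIic, (hsol y (hIic hy)).2.1.mono hIic,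
      (hsol y (hIic hy)).2.2.mono hIic⟩, rfl, rfl, rfl, ?_,
    fun y hy => ⟨hW y (hIic hy), hY y (hIic hy)⟩, x 0, x, ψ, φ, hδ.1,
    fun y _ => (hx y).hasDerivWithinAt, hx0, rfl, hψs.mono hIoc, hφs.mono hIoc,
    fun r hr => hψpos r (hIoc hr), ?_, ?_, fun r hr => (heqs r (hIoo hr)).2.2,
    ⟨_, mul_pos hk ha, hψasymp⟩, hφasymp,
    RicciSoliton.exists_continuousOn_extension (hψs.continuousOn.mono hIoo)
      (RicciSoliton.tendsto_zero_of_isEquivalent_rpow hα0 hψasymp),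
    RicciSoliton.not_exists_contDiffOn_extension (mul_pos hk ha) hα0 hα1 hδ.1 hψasymp⟩
  · intro T _ W' X' Y' hsol' hW' hX' hY'
    have hIcc : Icc T 0 ⊆ Iio η := Icc_subset_Iic_self.trans hIic
    exact RicciSoliton.IsSolution.eqOn_Icc
      (fun y hy => ⟨(hsol y (hIcc hy)).1.mono hIcc, (hsol y (hIcc hy)).2.1.mono hIcc,
        (hsol y (hIcc hy)).2.2.mono hIcc⟩) hsol' hW' hX' hY'
  · intro y hy
    obtain ⟨hxy, hgy⟩ := hgx y (hy.trans hb0)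
    obtain ⟨h1, h2, -⟩ := heqs _ hxy
    have hWy := (hW y (hy.trans hη)).ne'
    have hYy := (hY y (hy.trans hη)).ne'
    have hψy := (hψpos _ hxy).ne'
    have hs0 : √(n : ℝ) ≠ 0 := by positivity
    have hnn : (n : ℝ) = √(n : ℝ) ^ 2 := (Real.sq_sqrt (by positivity)).symm
    have hquot : deriv ψ (x y) / ψ (x y) = X y / (√(n : ℝ) * W y) := by
      rw [h1, mul_div_cancel_left₀ _ hψy, hgy]
    refine ⟨?_, ?_, ?_⟩
    · rw [hquot, h2, hgy]
      have : -((√(n : ℝ) * X y - 1) / W y) + n * (X y / (√(n : ℝ) * W y)) = 1 / W y := by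
        rw [hnn]
        simp only [Real.sqrt_sq (Real.sqrt_nonneg _)]
        field_simp
        ring
      rw [this, one_div_one_div]
    · rw [hquot]; field_simp
    · simp only [ψ, hgy]; field_simp
  · exact RicciSoliton.isGradientSolitonOn_warped n lam isOpen_Ioo (hψs.mono hIoo)
      (fun r hr => hψpos r (hIoo hr)) (hφs.mono hIoo) fun r hr => (heqs r (hIoo hr)).2.2
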